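/- Let $(P,d,\mu)$ be a metric space with a $\sigma$-finite Borel regular measure $\mu$ such that every ball has finite positive measure; assume that $\mu$ is non-atomic and doubling, i.e., there is $C\ge 1$ with $\mu(B(x,2r))\le C\,\mu(B(x,r))$ for all $x\in P$, $r>0$. Let $\mathcal M(P,\mu)$ be the set of extended real-valued $\mu$-measurable functions on $P$ (defined everywhere). Let $X$ be a quasi-Banach function lattice over $(P,\mu)$, i.e., $X=\{u\in\mathcal M(P,\mu):\|u\|_X<\infty\}$, where $\|\cdot\|_X:\mathcal M(P,\mu)\to[0,\infty]$ and, for some constant $c\ge 1$: $\|u\|_X=0$ iff $u=0$ a.e.; $\|au\|_X=|a|\,\|u\|_X$ for $a\in\mathbb R$; $\|u+v\|_X\le c(\|u\|_X+\|v\|_X)$; $|u|\le|v|$ a.e. implies $\|u\|_X\le\|v\|_X$; $\bigl\|\sum_{n\ge1}u_n\bigr\|_X\le\sum_{n\ge1}c^n\|u_n\|_X$ whenever $u_n\ge0$ a.e. for all $n$; and $\|u_n-u\|_X\to0$ implies $\|u_n\|_X\to\|u\|_X$. Assume that the quasi-norm is absolutely continuous: for every $u\in X$ we have $\|u\chi_{E_n}\|_X\to0$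 whenever $(E_n)$ is a decreasing sequence of measurable sets with $\mu(\bigcap_nE_n)=0$. A Borel function $g:P\to[0,\infty]$ is an upper gradient of $u:P\to[-\infty,\infty]$ if $|u(\gamma(0))-u(\gamma(l))|\le\int_\gamma g\,ds$ for every non-constant rectifiable curve $\gamma:[0,l]\to P$ parametrized by arc length, where $|(\pm\infty)-(\pm\infty)|=\infty$. Let $\|u\|_{N^1X}=\|u\|_X+\inf_g\|g\|_X$, the infimum being taken over all upper gradients $g$ of $u$, and $N^1X=\{u\in\mathcal M(P,\mu):\|u\|_{N^1X}<\infty\}$. For $v\in L^1_{\mathrm{loc}}(P)$ (that is, $v$ is integrable over every ball) let $$v^\sharp_1(x)=\sup_{r>0}\frac1r\,\frac1{\mu(B(x,r))}\int_{B(x,r)}|v-v_{B(x,r)}|\,d\mu,\qquad v_B=\frac1{\mu(B)}\int_Bv\,d\mu .$$ **Theorem.** Let $u\in N^1X$. Suppose that $\bigl\|\sigma\chi_{\{v^\sharp_1>\sigma\}}\bigr\|_X\to0$ as $\sigma\to\infty$ for every truncation $v=\max\{\min\{u,\tau\},-\tau\}$, $\tau\in(0,\infty)$, of $u$ (the rate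 of convergence may depend on $\tau$); or suppose that $u\in L^1_{\mathrm{loc}}(P)$ and $\bigl\|\sigma\chi_{\{u^\sharp_1>\sigma\}}\bigr\|_X\to0$ as $\sigma\to\infty$. Then, for every $\varepsilon>0$, there is a Lipschitz function $u_\varepsilon:P\to\mathbb R$ with $u_\varepsilon\in N^1X$ and $\|u-u_\varepsilon\|_{N^1X}<\varepsilon$. -/

import Mathlib

open MeasureTheory Filter Topology Set
open scoped NNReal ENNReal

/-- `μ` is non-atomic: it has no atoms, an atom being a measurable set `A` of positive measure such
that every measurable `B ⊆ A` satisfies `μ B = 0` or `μ (A \ B) = 0`. -/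
def IsNonatomic {P : Type*} [MeasurableSpace P] (μ : Measure P) : Prop :=
  ∀ A : Set P, MeasurableSet A → 0 < μ A → ∃ B ⊆ A, MeasurableSet B ∧ 0 < μ B ∧ 0 < μ (A \ B)

/-- A quasi-Banach function lattice over `(P, μ)`, given by its quasi-norm
`‖·‖_X : M(P, μ) → [0, ∞]` on the extended real-valued `μ`-measurable functions, which are defined
everywhere (no identification almost everywhere). The quasi-norm determines the space:
`X = {u ∈ M(P, μ) : ‖u‖_X < ∞}`. Here "`μ`-measurable" means measurable with respect to
the completion of the underlying sigma-algebra, that is, `AEMeasurable`; values of `nrm` at functions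
that are not `μ`-measurable are never used. -/
structure QuasiBanachFunctionLattice {P : Type*} [MeasurableSpace P] (μ : Measure P) where
  /-- the quasi-norm -/
  nrm : (P → EReal) → ℝ≥0∞
  /-- the modulus of concavity -/
  c : ℝ≥0
  one_le_c : 1 ≤ c
  nrm_eq_zero_iff : ∀ u : P → EReal, AEMeasurable u μ → (nrm u = 0 ↔ u =ᵐ[μ] 0)
  nrm_smul : ∀ (a : ℝ) (u : P → EReal), AEMeasurable u μ →
    nrm (fun x => (a : EReal) * u x) = ENNReal.ofReal |a| * nrm u
  nrm_add_le : ∀ u v : P → EReal, AEMeasurable u μ → AEMeasurable v μ →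
    nrm (fun x => u x + v x) ≤ c * (nrm u + nrm v)
  /-- the lattice property -/
  nrm_mono : ∀ u v : P → EReal, AEMeasurable u μ → AEMeasurable v μ →
    (∀ᵐ x ∂μ, (u x).abs ≤ (v x).abs) → nrm u ≤ nrm v
  /-- the Riesz–Fischer property `‖∑ u_n‖ ≤ ∑ c ^ n ‖u_n‖`, `n = 1, 2, …`, for functions that are
  nonnegative a.e. (the sequence is indexed from `0` here) -/
  riesz_fischer : ∀ u : ℕ → P → EReal, (∀ n, AEMeasurable (u n) μ) →
    (∀ n, ∀ᵐ x ∂μ, 0 ≤ u n x) →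
    nrm (fun x => ((∑' n, (u n x).toENNReal : ℝ≥0∞) : EReal)) ≤
      ∑' n, (c : ℝ≥0∞) ^ (n + 1) * nrm (u n)
  /-- continuity of the quasi-norm -/
  nrm_continuous : ∀ (u : ℕ → P → EReal) (v : P → EReal), (∀ n, AEMeasurable (u n) μ) →
    AEMeasurable v μ → Tendsto (fun n => nrm (fun x => u n x - v x)) atTop (𝓝 0) →
    Tendsto (fun n => nrm (u n)) atTop (𝓝 (nrm v))

namespace QuasiBanachFunctionLattice

variable {P : Type*} [MeasurableSpace P] {μ : Measure P}

/-- Membership in `X`. -/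
def Mem (X : QuasiBanachFunctionLattice μ) (u : P → EReal) : Prop :=
  AEMeasurable u μ ∧ X.nrm u < ∞

/-- The quasi-norm of `X` is absolutely continuous. -/
def AbsolutelyContinuousNorm (X : QuasiBanachFunctionLattice μ) : Prop :=
  ∀ u : P → EReal, X.Mem u → ∀ E : ℕ → Set P, (∀ n, NullMeasurableSet (E n) μ) → Antitone E →
    μ (⋂ n, E n) = 0 → Tendsto (fun n => X.nrm ((E n).indicator u)) atTop (𝓝 0)

end QuasiBanachFunctionLattice

/-- A Borel function `g : P → [0, ∞]` is an upper gradient of `u` if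
`|u(γ(0)) - u(γ(l))| ≤ ∫_γ g ds` for every non-constant rectifiable curve `γ : [0, l] → P`
parametrized by arc length. In `EReal` one has `⊤ - ⊤ = ⊥ - ⊥ = ⊥`, so that
the convention `|(±∞) - (±∞)| = ∞` is in force. -/
def IsUpperGradient {P : Type*} [PseudoEMetricSpace P] [MeasurableSpace P]
    (u : P → EReal) (g : P → ℝ≥0∞) : Prop :=
  Measurable g ∧ ∀ (l : ℝ) (γ : ℝ → P), 0 < l → HasUnitSpeedOn γ (Icc 0 l) →
    (u (γ 0) - u (γ l)).abs ≤ ∫⁻ t in Icc 0 l, g (γ t)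

namespace QuasiBanachFunctionLattice

variable {P : Type*} [PseudoEMetricSpace P] [MeasurableSpace P] {μ : Measure P}

/-- The Newtonian quasi-seminorm `‖u‖_{N¹X} = ‖u‖_X + inf_g ‖g‖_X`, the infimum being taken over
all upper gradients `g` of `u`. -/
noncomputable def newtonNorm (X : QuasiBanachFunctionLattice μ) (u : P → EReal) : ℝ≥0∞ :=
  X.nrm u + ⨅ (g : P → ℝ≥0∞) (_ : IsUpperGradient u g), X.nrm (fun x => (g x : EReal))

/-- Membership in the Newtonian space `N¹X`. -/
def MemNewton (X : QuasiBanachFunctionLattice μ) (u : P → EReal) : Prop :=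
  AEMeasurable u μ ∧ X.newtonNorm u < ∞

end QuasiBanachFunctionLattice

/-- The truncation of `u` at the levels `±τ`. -/
noncomputable def truncation {P : Type*} (u : P → EReal) (τ : ℝ) : P → EReal :=
  fun x => max (min (u x) (τ : EReal)) (-(τ : EReal))

/-- `u ∈ L¹_loc`: `u` is integrable over every ball. -/
def LocIntegrableOnBalls {P : Type*} [PseudoMetricSpace P] [MeasurableSpace P]
    (μ : Measure P) (u : P → EReal) : Prop :=
  AEMeasurable u μ ∧ ∀ (x : P) (r : ℝ), ∫⁻ y in Metric.ball x r, (u y).abs ∂μ < ∞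

/-- The fractional sharp maximal function
`u^♯_1(x) = sup_{r > 0} (1 / r) ⨍_{B(x, r)} |u - u_{B(x, r)}| dμ` of `u ∈ L¹_loc`. Such a function is
finite a.e., and the integral mean `u_{B(x, r)}` is the mean of its real part. -/
noncomputable def fracSharp {P : Type*} [PseudoMetricSpace P] [MeasurableSpace P]
    (μ : Measure P) (u : P → EReal) (x : P) : ℝ≥0∞ :=
  ⨆ (r : ℝ) (_ : 0 < r), (ENNReal.ofReal r)⁻¹ *
    ⨍⁻ y in Metric.ball x r,
      (u y - ((⨍ z in Metric.ball x r, (u z).toReal ∂μ : ℝ) : EReal)).abs ∂μ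

/-- The weak estimate `‖σ χ_{u^♯_1 > σ}‖_X → 0` as `σ → ∞`. -/
def SharpWeakEstimate {P : Type*} [PseudoMetricSpace P] [MeasurableSpace P] {μ : Measure P}
    (X : QuasiBanachFunctionLattice μ) (u : P → EReal) : Prop :=
  Tendsto (fun σ : ℝ => X.nrm
    ({x | ENNReal.ofReal σ < fracSharp μ u x}.indicator (fun _ => (σ : EReal)))) atTop (𝓝 0)

/-!
By absolute continuity of the quasi-norm, the truncations of `u` converge to `u` in `N¹X`, and the
weak estimate passes from `u` to its truncations because truncating is `1`-Lipschitz. So let `f` be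
bounded. If the fractional sharp maximal function of `f` is at most `σ` at two Lebesgue points `x`
and `y`, then telescoping over the balls `B(x, 2 r / 2 ^ i)` and `B(y, r / 2 ^ i)` for `r`
slightly larger than `d(x, y)`, and comparing the averages over the two largest balls, gives
`|f x - f y| ≤ D σ d(x, y)`, where `D` depends only on the doubling constant. Hence `f` agrees
outside `E_σ = {f♯ > σ} ∪ N`, `N` being null, with a `D σ`-Lipschitz function `w_σ` that obeys the
same bounds as `f`.

If `g` is an upper gradient of `f`, then `g + D σ` is one of `f - w_σ`, and since `f - w_σ` vanishes
outside `E_σ` it may be cut off to `E_σ`, up to an arbitrarily small multiple of `g`. The norm of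
`(g + D σ) χ_{E_σ}` tends to `0`, the first term by absolute continuity and the second by the weak
estimate.
-/

section EReal

theorem measurable_ereal_abs : Measurable EReal.abs :=
  EReal.measurable_of_measurable_real
    (show Measurable fun x : ℝ => ENNReal.ofReal |x| by fun_prop)

theorem ereal_abs_coe_ennreal (a : ℝ≥0∞) : (a : EReal).abs = a := by
  induction a using ENNReal.recTopCoe with
  | top => rfl
  | coe a =>
    change ((a : ℝ) : EReal).abs = a
    rw [EReal.abs_def, NNReal.abs_eq, ENNReal.ofReal_coe_nnreal]

theorem ereal_abs_coe_sub_coe (a b : ℝ) : ((a : EReal) - (b : EReal)).abs = edist a b := by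
  rw [← EReal.coe_sub, EReal.abs_def, edist_dist, Real.dist_eq]

theorem ereal_abs_eq_top_or_exists_coe (x : EReal) : x.abs = ∞ ∨ ∃ a : ℝ, x = a := by
  induction x <;> simp

-- This is the convention `|(±∞) - (±∞)| = ∞`: bounds by `(x - y).abs` only concern real `x`, `y`.
theorem ereal_abs_sub_eq_top_or_exists_coe (x y : EReal) :
    (x - y).abs = ∞ ∨ ∃ a b : ℝ, x = a ∧ y = b := by
  induction x <;> induction y <;> simp

theorem ereal_abs_add_sub_add_le (x y z w : EReal) :
    ((x + y) - (z + w)).abs ≤ (x - z).abs + (y - w).abs := by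
  obtain hxz | ⟨a, c, rfl, rfl⟩ := ereal_abs_sub_eq_top_or_exists_coe x z
  · simp [hxz]
  obtain hyw | ⟨b, d, rfl, rfl⟩ := ereal_abs_sub_eq_top_or_exists_coe y w
  · simp [hyw]
  simpa only [← EReal.coe_add, ereal_abs_coe_sub_coe] using edist_add_add_le a b c d

theorem ereal_abs_neg_sub_neg_le (x y : EReal) : (-x - -y).abs ≤ (x - y).abs := by
  obtain h | ⟨a, b, rfl, rfl⟩ := ereal_abs_sub_eq_top_or_exists_coe x y
  · simp [h]
  · rw [← EReal.coe_neg, ← EReal.coe_neg, ereal_abs_coe_sub_coe, ereal_abs_coe_sub_coe,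
      edist_neg_neg]

theorem ereal_sub_coe_add_coe_sub_coe (x : EReal) (a b : ℝ) :
    (x - a) + (a - b : EReal) = x - b := by
  induction x with
  | coe x => norm_cast; ring
  | top => simp [← EReal.coe_sub]
  | bot => simp [← EReal.coe_sub]

end EReal

namespace QuasiBanachFunctionLattice

section NonnegativeFunctions

variable {P : Type*} [MeasurableSpace P] {μ : Measure P}

/-- The quasi-norm of a nonnegative function, that is, the restriction of `X.nrm` to functions with
values in `[0, ∞]`. -/
noncomputable def enrm (X : QuasiBanachFunctionLattice μ) (h : P → ℝ≥0∞) : ℝ≥0∞ :=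
  X.nrm (fun x => (h x : EReal))

variable (X : QuasiBanachFunctionLattice μ)

theorem enrm_mono {h k : P → ℝ≥0∞} (hh : AEMeasurable h μ) (hk : AEMeasurable k μ)
    (hle : h ≤ᵐ[μ] k) : X.enrm h ≤ X.enrm k :=
  X.nrm_mono _ _ hh.coe_ereal_ennreal hk.coe_ereal_ennreal <| hle.mono fun x hx => by
    simpa only [ereal_abs_coe_ennreal] using hx

theorem enrm_congr_ae {h k : P → ℝ≥0∞} (hh : AEMeasurable h μ) (hhk : h =ᵐ[μ] k) :
    X.enrm h = X.enrm k :=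
  (X.enrm_mono hh (hh.congr hhk) hhk.le).antisymm (X.enrm_mono (hh.congr hhk) hh hhk.symm.le)

theorem nrm_eq_enrm_abs {u : P → EReal} (hu : AEMeasurable u μ) :
    X.nrm u = X.enrm (fun x => (u x).abs) := by
  have hua := (measurable_ereal_abs.comp_aemeasurable hu).coe_ereal_ennreal
  exact le_antisymm
    (X.nrm_mono _ _ hu hua (ae_of_all _ fun x => (ereal_abs_coe_ennreal _).ge))
    (X.nrm_mono _ _ hua hu (ae_of_all _ fun x => (ereal_abs_coe_ennreal _).le))

theorem nrm_le_enrm {u : P → EReal} {h : P → ℝ≥0∞} (hu : AEMeasurable u μ)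
    (hh : AEMeasurable h μ) (hle : ∀ᵐ x ∂μ, (u x).abs ≤ h x) : X.nrm u ≤ X.enrm h :=
  (X.nrm_eq_enrm_abs hu).trans_le (X.enrm_mono (measurable_ereal_abs.comp_aemeasurable hu) hh hle)

theorem enrm_add_le {h k : P → ℝ≥0∞} (hh : AEMeasurable h μ) (hk : AEMeasurable k μ) :
    X.enrm (fun x => h x + k x) ≤ X.c * (X.enrm h + X.enrm k) := by
  have := X.nrm_add_le _ _ hh.coe_ereal_ennreal hk.coe_ereal_ennreal
  simpa only [enrm, EReal.coe_ennreal_add] using this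

theorem enrm_const_mul (a : ℝ≥0) {h : P → ℝ≥0∞} (hh : AEMeasurable h μ) :
    X.enrm (fun x => a * h x) = a * X.enrm h := by
  have := X.nrm_smul a _ hh.coe_ereal_ennreal
  rw [NNReal.abs_eq, ENNReal.ofReal_coe_nnreal] at this
  simp only [enrm, ← this, EReal.coe_ennreal_mul]
  rfl

theorem enrm_eq_zero_iff {h : P → ℝ≥0∞} (hh : AEMeasurable h μ) : X.enrm h = 0 ↔ h =ᵐ[μ] 0 := by
  rw [enrm, X.nrm_eq_zero_iff _ hh.coe_ereal_ennreal]
  simp only [EventuallyEq, Pi.zero_apply, EReal.coe_ennreal_eq_zero]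

theorem nrm_indicator_const (a : ℝ) {E : Set P} (hE : NullMeasurableSet E μ) :
    X.nrm (E.indicator fun _ => (a : EReal)) = ENNReal.ofReal |a| * X.enrm (E.indicator 1) := by
  have hind : AEMeasurable (E.indicator (1 : P → ℝ≥0∞)) μ := aemeasurable_one.indicator₀ hE
  rw [enrm, ← X.nrm_smul a _ hind.coe_ereal_ennreal]
  congr 1
  funext x
  by_cases hx : x ∈ E <;> simp [hx]

theorem enrm_indicator_add_const_le (K : ℝ≥0) {g : P → ℝ≥0∞} (hg : AEMeasurable g μ) {E : Set P}
    (hE : NullMeasurableSet E μ) :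
    X.enrm (E.indicator fun x => g x + K) ≤
      X.c * (X.enrm (E.indicator g) + K * X.enrm (E.indicator 1)) := by
  have h1 : AEMeasurable (E.indicator (1 : P → ℝ≥0∞)) μ := aemeasurable_one.indicator₀ hE
  rw [← X.enrm_const_mul K h1]
  convert X.enrm_add_le (hg.indicator₀ hE) (h1.const_mul (K : ℝ≥0∞)) using 2 with x
  ext x
  by_cases hx : x ∈ E <;> simp [hx]

variable {X}

theorem AbsolutelyContinuousNorm.tendsto_enrm_indicator (hX : X.AbsolutelyContinuousNorm)
    {h : P → ℝ≥0∞} (hh : AEMeasurable h μ) (hfin : X.enrm h < ∞) {E : ℕ → Set P}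
    (hE : ∀ n, NullMeasurableSet (E n) μ) (hanti : Antitone E) (hnull : μ (⋂ n, E n) = 0) :
    Tendsto (fun n => X.enrm ((E n).indicator h)) atTop (𝓝 0) := by
  convert hX _ ⟨hh.coe_ereal_ennreal, hfin⟩ E hE hanti hnull using 3 with n
  rw [enrm]
  congr 1
  funext x
  by_cases hx : x ∈ E n <;> simp [hx]

theorem measure_iInter_eq_zero_of_tendsto_enrm {E : ℕ → Set P}
    (hE : ∀ n, NullMeasurableSet (E n) μ)
    (h : Tendsto (fun n => X.enrm ((E n).indicator 1)) atTop (𝓝 0)) : μ (⋂ n, E n) = 0 := by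
  have hind {s : Set P} (hs : NullMeasurableSet s μ) :
      AEMeasurable (s.indicator (1 : P → ℝ≥0∞)) μ := aemeasurable_one.indicator₀ hs
  have hI : NullMeasurableSet (⋂ n, E n) μ := NullMeasurableSet.iInter hE
  have hzero : X.enrm ((⋂ n, E n).indicator 1) = 0 :=
    le_zero_iff.1 <| ge_of_tendsto' h fun n => X.enrm_mono (hind hI) (hind (hE n)) <|
      ae_of_all _ (indicator_le_indicator_of_subset (iInter_subset _ n) fun _ => zero_le)
  rw [X.enrm_eq_zero_iff (hind hI)] at hzero
  rw [measure_eq_zero_iff_ae_notMem]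
  filter_upwards [hzero] with x hx hmem
  simp [indicator_of_mem hmem] at hx

theorem Mem.tendsto_enrm_indicator_abs_gt {u : P → EReal} (hu : X.Mem u) :
    Tendsto (fun n : ℕ => X.enrm ({x | (n : ℝ≥0∞) < (u x).abs}.indicator 1)) atTop (𝓝 0) := by
  have hua : AEMeasurable (fun x => (u x).abs) μ := measurable_ereal_abs.comp_aemeasurable hu.1
  have hlim : Tendsto (fun n : ℕ => X.nrm u / n) atTop (𝓝 0) := by
    simpa [div_eq_mul_inv] using
      ENNReal.Tendsto.const_mul ENNReal.tendsto_inv_nat_nhds_zero (Or.inr hu.2.ne)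
  refine tendsto_of_tendsto_of_tendsto_of_le_of_le' tendsto_const_nhds hlim
    (Eventually.of_forall fun _ => zero_le) ?_
  filter_upwards [eventually_ne_atTop 0] with n hn
  have hind : AEMeasurable ({x | (n : ℝ≥0∞) < (u x).abs}.indicator (1 : P → ℝ≥0∞)) μ :=
    aemeasurable_one.indicator₀ (nullMeasurableSet_lt aemeasurable_const hua)
  have hmul := X.enrm_const_mul n hind
  rw [ENNReal.coe_natCast] at hmul
  rw [ENNReal.le_div_iff_mul_le (Or.inl (by exact_mod_cast hn))
    (Or.inl (ENNReal.natCast_ne_top n)), mul_comm, X.nrm_eq_enrm_abs hu.1,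
    ← hmul]
  refine X.enrm_mono (hind.const_mul _) hua (ae_of_all _ fun x => ?_)
  by_cases hx : (n : ℝ≥0∞) < (u x).abs
  · simpa [hx] using hx.le
  · simp [hx]

end NonnegativeFunctions

end QuasiBanachFunctionLattice

section Curves

theorem continuousOn_Icc_of_edist_le_setLIntegral {E : Type*} [PseudoEMetricSpace E] {φ : ℝ → E}
    {G : ℝ → ℝ≥0∞} {a b : ℝ} (hfin : ∫⁻ t in Icc a b, G t ≠ ∞)
    (h : ∀ ⦃s t⦄, a ≤ s → s ≤ t → t ≤ b → edist (φ s) (φ t) ≤ ∫⁻ r in Icc s t, G r) :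
    ContinuousOn φ (Icc a b) := by
  intro t ht
  have hbound : ∀ s ∈ Icc a b,
      edist (φ s) (φ t) ≤ ∫⁻ r in uIcc s t, G r ∂volume.restrict (Icc a b) := by
    intro s hs
    rw [Measure.restrict_restrict measurableSet_uIcc, inter_eq_left.2 (uIcc_subset_Icc hs ht)]
    rcases le_total s t with hst | hts
    · rw [uIcc_of_le hst]
      exact h hs.1 hst ht.2
    · rw [uIcc_of_ge hts, edist_comm]
      exact h ht.1 hts hs.2
  have hvol : Tendsto (fun s => volume.restrict (Icc a b) (uIcc s t)) (𝓝[Icc a b] t) (𝓝 0) := by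
    have hlen : Tendsto (fun s => volume (uIcc s t)) (𝓝[Icc a b] t) (𝓝 0) := by
      have hcont : Continuous fun s : ℝ => ENNReal.ofReal |t - s| :=
        ENNReal.continuous_ofReal.comp (by fun_prop)
      simpa only [Real.volume_interval, ContinuousWithinAt, sub_self, abs_zero, ENNReal.ofReal_zero]
        using hcont.continuousWithinAt (s := Icc a b) (x := t)
    exact tendsto_of_tendsto_of_tendsto_of_le_of_le tendsto_const_nhds hlen (fun _ => zero_le)
      fun _ => Measure.restrict_apply_le _ _
  rw [ContinuousWithinAt, tendsto_iff_edist_tendsto_0]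
  exact tendsto_of_tendsto_of_tendsto_of_le_of_le' tendsto_const_nhds
    (tendsto_setLIntegral_zero hfin hvol) (Eventually.of_forall fun _ => zero_le)
    (eventually_mem_nhdsWithin.mono hbound)

-- Only the pieces of the curve before its first and after its last visit to `p` contribute.
theorem edist_le_setLIntegral_of_le_of_ne {E : Type*} [EMetricSpace E] {φ : ℝ → E} {p : E}
    {G H : ℝ → ℝ≥0∞} {a b : ℝ} (hab : a ≤ b) (hfin : ∫⁻ t in Icc a b, G t ≠ ∞)
    (h : ∀ ⦃s t⦄, a ≤ s → s ≤ t → t ≤ b → edist (φ s) (φ t) ≤ ∫⁻ r in Icc s t, G r)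
    (hGH : ∀ t ∈ Icc a b, φ t ≠ p → G t ≤ H t) :
    edist (φ a) (φ b) ≤ ∫⁻ t in Icc a b, H t := by
  by_cases hp : ∃ t ∈ Icc a b, φ t = p
  · have hZ : IsCompact (Icc a b ∩ φ ⁻¹' {p}) := isCompact_Icc.of_isClosed_subset
      ((continuousOn_Icc_of_edist_le_setLIntegral hfin h).preimage_isClosed_of_isClosed
        isClosed_Icc isClosed_singleton) inter_subset_left
    obtain ⟨s, ⟨hs, hsp⟩, hfirst⟩ := hZ.exists_isLeast hp
    obtain ⟨t, ⟨ht, htp⟩, hlast⟩ := hZ.exists_isGreatest hp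
    have hst : s ≤ t := hfirst ⟨ht, htp⟩
    have hsub : Ico a s ∪ Ioc t b ⊆ Icc a b := union_subset
      (Ico_subset_Icc_self.trans (Icc_subset_Icc le_rfl hs.2))
      (Ioc_subset_Icc_self.trans (Icc_subset_Icc ht.1 le_rfl))
    have hGH' : ∀ r ∈ Ico a s ∪ Ioc t b, G r ≤ H r := fun r hr => hGH r (hsub hr) fun hrp =>
      hr.elim (fun hrs => hrs.2.not_ge (hfirst ⟨hsub hr, hrp⟩))
        (fun hrt => hrt.1.not_ge (hlast ⟨hsub hr, hrp⟩))
    have hdisj : Disjoint (Ico a s) (Ioc t b) :=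
      disjoint_left.2 fun r hrs hrt => (hrs.2.trans_le hst).not_gt hrt.1
    calc edist (φ a) (φ b)
        ≤ edist (φ a) (φ s) + edist (φ t) (φ b) := by
          rw [show φ s = p from hsp, show φ t = p from htp]
          exact edist_triangle _ _ _
      _ ≤ (∫⁻ r in Ico a s, G r) + ∫⁻ r in Ioc t b, G r := by
          rw [setLIntegral_congr Ico_ae_eq_Icc, setLIntegral_congr Ioc_ae_eq_Icc]
          exact add_le_add (h le_rfl hs.1 hs.2) (h ht.1 ht.2 le_rfl)
      _ = ∫⁻ r in Ico a s ∪ Ioc t b, G r := (lintegral_union measurableSet_Ioc hdisj).symm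
      _ ≤ ∫⁻ r in Ico a s ∪ Ioc t b, H r :=
          setLIntegral_mono' (measurableSet_Ico.union measurableSet_Ioc) hGH'
      _ ≤ ∫⁻ r in Icc a b, H r := lintegral_mono_set hsub
  · push Not at hp
    exact (h le_rfl hab le_rfl).trans
      (setLIntegral_mono' measurableSet_Icc fun t ht => hGH t ht (hp t ht))

theorem hasUnitSpeedOn_comp_const_add {E : Type*} [PseudoEMetricSpace E] {γ : ℝ → E} {l a b : ℝ}
    (h : HasUnitSpeedOn γ (Icc 0 l)) (ha : 0 ≤ a) (hb : b ≤ l) :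
    HasUnitSpeedOn (fun t => γ (a + t)) (Icc 0 (b - a)) := by
  intro x hx y hy
  have hsub : Icc x y ⊆ Icc 0 (b - a) := Icc_subset_Icc hx.1 hy.2
  have hsub' : Icc (a + x) (a + y) ⊆ Icc 0 l :=
    Icc_subset_Icc (by linarith [hx.1]) (by linarith [hy.2])
  have hshift := eVariationOn.comp_eq_of_monotoneOn γ (t := Icc x y) (fun t => a + t)
    (fun s _ t _ hst => by simpa using hst)
  have hspeed := h (x := a + x) ⟨by linarith [hx.1], by linarith [hx.2]⟩ (y := a + y)
    ⟨by linarith [hy.1], by linarith [hy.2]⟩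
  rw [inter_eq_right.2 hsub', add_sub_add_left_eq_sub] at hspeed
  rw [image_const_add_Icc, hspeed] at hshift
  rwa [inter_eq_right.2 hsub]

theorem edist_le_ofReal_of_hasUnitSpeedOn {E : Type*} [PseudoEMetricSpace E] {γ : ℝ → E} {l : ℝ}
    (h : HasUnitSpeedOn γ (Icc 0 l)) (hl : 0 ≤ l) : edist (γ 0) (γ l) ≤ ENNReal.ofReal l := by
  have h0 : (0 : ℝ) ∈ Icc 0 l := left_mem_Icc.2 hl
  have h1 : l ∈ Icc 0 l := right_mem_Icc.2 hl
  have hlength := h h0 h1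
  rw [inter_self, NNReal.coe_one, one_mul, sub_zero] at hlength
  exact hlength ▸ eVariationOn.edist_le γ h0 h1

end Curves

namespace IsUpperGradient

variable {P : Type*} [PseudoEMetricSpace P] [MeasurableSpace P] {u v : P → EReal}
  {g h : P → ℝ≥0∞}

theorem mono_abs_sub (hg : IsUpperGradient u g)
    (huv : ∀ x y, (v x - v y).abs ≤ (u x - u y).abs) : IsUpperGradient v g :=
  ⟨hg.1, fun l γ hl hγ => (huv _ _).trans (hg.2 l γ hl hγ)⟩

theorem neg (hg : IsUpperGradient u g) : IsUpperGradient (fun x => -u x) g :=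
  hg.mono_abs_sub fun _ _ => ereal_abs_neg_sub_neg_le _ _

theorem add (hg : IsUpperGradient u g) (hh : IsUpperGradient v h) :
    IsUpperGradient (fun x => u x + v x) (fun x => g x + h x) :=
  ⟨hg.1.add hh.1, fun l γ hl hγ => (ereal_abs_add_sub_add_le _ _ _ _).trans <|
    (add_le_add (hg.2 l γ hl hγ) (hh.2 l γ hl hγ)).trans (le_lintegral_add _ _)⟩

theorem of_lipschitzWith {w : P → ℝ} {K : ℝ≥0} (hw : LipschitzWith K w) :
    IsUpperGradient (fun x => (w x : EReal)) (fun _ => (K : ℝ≥0∞)) := by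
  refine ⟨measurable_const, fun l γ hl hγ => ?_⟩
  rw [ereal_abs_coe_sub_coe, setLIntegral_const, Real.volume_Icc, sub_zero]
  exact (hw _ _).trans (mul_le_mul_right (edist_le_ofReal_of_hasUnitSpeedOn hγ hl.le) _)

section FiniteLineIntegral

variable {γ : ℝ → P} {l : ℝ}

theorem abs_sub_le_setLIntegral_Icc (hg : IsUpperGradient u g) (hγ : HasUnitSpeedOn γ (Icc 0 l))
    {a b : ℝ} (ha : 0 ≤ a) (hab : a < b) (hb : b ≤ l) :
    (u (γ a) - u (γ b)).abs ≤ ∫⁻ t in Icc a b, g (γ t) := by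
  have hsub := hg.2 (b - a) _ (sub_pos.2 hab) (hasUnitSpeedOn_comp_const_add hγ ha hb)
  simp only [add_zero, add_sub_cancel] at hsub
  have hpre : (a + ·) ⁻¹' Icc a b = Icc 0 (b - a) := by rw [preimage_const_add_Icc, sub_self]
  rwa [← hpre, (measurePreserving_add_left volume a).setLIntegral_comp_preimage_emb
    (measurableEmbedding_addLeft a) (fun t => g (γ t))] at hsub

theorem coe_toReal_comp (hg : IsUpperGradient u g) (hγ : HasUnitSpeedOn γ (Icc 0 l)) (hl : 0 < l)
    (hfin : ∫⁻ t in Icc 0 l, g (γ t) ≠ ∞) {t : ℝ} (ht : t ∈ Icc 0 l) :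
    ((u (γ t)).toReal : EReal) = u (γ t) := by
  have hreal : ∀ a b, 0 ≤ a → a < b → b ≤ l → ∃ x y : ℝ, u (γ a) = x ∧ u (γ b) = y :=
    fun a b ha hab hb => (ereal_abs_sub_eq_top_or_exists_coe _ _).resolve_left <|
      ne_top_of_le_ne_top hfin <| (hg.abs_sub_le_setLIntegral_Icc hγ ha hab hb).trans <|
        lintegral_mono_set (Icc_subset_Icc ha hb)
  rcases ht.2.lt_or_eq with htl | rfl
  · obtain ⟨x, -, hx, -⟩ := hreal t l ht.1 htl le_rfl
    rw [hx, EReal.toReal_coe]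
  · obtain ⟨-, y, -, hy⟩ := hreal 0 t le_rfl hl le_rfl
    rw [hy, EReal.toReal_coe]

theorem abs_sub_le_setLIntegral_indicator (hg : IsUpperGradient u g)
    (hγ : HasUnitSpeedOn γ (Icc 0 l)) (hl : 0 < l) (hfin : ∫⁻ t in Icc 0 l, g (γ t) ≠ ∞)
    {F : Set P} (hzero : ∀ x ∉ F, u x = 0) :
    (u (γ 0) - u (γ l)).abs ≤ ∫⁻ t in Icc 0 l, F.indicator g (γ t) := by
  have hreal : ∀ t ∈ Icc 0 l, ((u (γ t)).toReal : EReal) = u (γ t) :=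
    fun t ht => hg.coe_toReal_comp hγ hl hfin ht
  rw [← hreal 0 (left_mem_Icc.2 hl.le), ← hreal l (right_mem_Icc.2 hl.le), ereal_abs_coe_sub_coe]
  refine edist_le_setLIntegral_of_le_of_ne (φ := fun t => (u (γ t)).toReal) (p := 0) hl.le hfin
    (fun s t hs hst ht => ?_) fun t _ hne => ?_
  · rcases hst.eq_or_lt with rfl | hlt
    · simp
    · rw [← ereal_abs_coe_sub_coe, hreal s ⟨hs, hst.trans ht⟩, hreal t ⟨hs.trans hst, ht⟩]
      exact hg.abs_sub_le_setLIntegral_Icc hγ hs hlt ht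
  · have hmem : γ t ∈ F := by
      by_contra hmem
      exact hne (by rw [hzero _ hmem, EReal.toReal_zero])
    rw [indicator_of_mem hmem]

end FiniteLineIntegral

-- The term `δ * g` is infinite on the curves along which `g` is not integrable. On the others
-- `g + K` is integrable, curves having finite length, so that adding `δ * g` suffices. Adding
-- `δ * (g + K)` would not do later on, since constants may have infinite norm.
theorem indicator_add_const_mul {K δ : ℝ≥0} (hδ : δ ≠ 0) (hg : Measurable g)
    (hu : IsUpperGradient u (fun x => g x + K)) {F : Set P} (hF : MeasurableSet F)
    (hzero : ∀ x ∉ F, u x = 0) :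
    IsUpperGradient u (fun x => F.indicator (fun x => g x + K) x + δ * g x) := by
  refine ⟨(hu.1.indicator hF).add (hg.const_mul _), fun l γ hl hγ => ?_⟩
  by_cases hfin : ∫⁻ t in Icc 0 l, g (γ t) = ∞
  · calc (u (γ 0) - u (γ l)).abs ≤ ∫⁻ t in Icc 0 l, δ * g (γ t) := by
          rw [lintegral_const_mul' _ _ ENNReal.coe_ne_top, hfin,
            ENNReal.mul_top (ENNReal.coe_ne_zero.2 hδ)]
          exact le_top
      _ ≤ _ := lintegral_mono fun t => le_add_self
  · have hfin' : ∫⁻ t in Icc 0 l, (g (γ t) + K) ≠ ∞ := by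
      rw [lintegral_add_right _ measurable_const, setLIntegral_const, Real.volume_Icc]
      finiteness
    exact (hu.abs_sub_le_setLIntegral_indicator hγ hl hfin' hzero).trans
      (lintegral_mono fun t => le_self_add)

end IsUpperGradient

namespace QuasiBanachFunctionLattice

section NewtonNorm

variable {P : Type*} [PseudoEMetricSpace P] [MeasurableSpace P] {μ : Measure P}
  {X : QuasiBanachFunctionLattice μ} {u v : P → EReal}

/-- The gradient part `inf_g ‖g‖_X` of the Newtonian quasi-seminorm, the infimum being taken over
all upper gradients `g` of `u`. -/
noncomputable def gradientNorm (X : QuasiBanachFunctionLattice μ) (u : P → EReal) : ℝ≥0∞ :=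
  ⨅ (g : P → ℝ≥0∞) (_ : IsUpperGradient u g), X.enrm g

theorem newtonNorm_eq_nrm_add_gradientNorm (X : QuasiBanachFunctionLattice μ) (u : P → EReal) :
    X.newtonNorm u = X.nrm u + X.gradientNorm u :=
  rfl

theorem gradientNorm_le {g : P → ℝ≥0∞} (hg : IsUpperGradient u g) : X.gradientNorm u ≤ X.enrm g :=
  iInf₂_le g hg

theorem MemNewton.mem (hu : X.MemNewton u) : X.Mem u :=
  ⟨hu.1, (ENNReal.add_lt_top.1 hu.2).1⟩

theorem MemNewton.exists_isUpperGradient (hu : X.MemNewton u) :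
    ∃ g, IsUpperGradient u g ∧ X.enrm g < ∞ := by
  have h : X.gradientNorm u < ∞ := (ENNReal.add_lt_top.1 hu.2).2
  simpa only [gradientNorm, iInf_lt_iff, exists_prop] using h

theorem gradientNorm_add_le :
    X.gradientNorm (fun x => u x + v x) ≤ X.c * (X.gradientNorm u + X.gradientNorm v) := by
  have hc : (X.c : ℝ≥0∞) ≠ 0 := ENNReal.coe_ne_zero.2 (zero_lt_one.trans_le X.one_le_c).ne'
  simp only [gradientNorm, iInf_subtype', ENNReal.iInf_add, ENNReal.add_iInf,
    ENNReal.mul_iInf_of_ne hc ENNReal.coe_ne_top]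
  exact le_iInf fun h => le_iInf fun g => iInf_le_of_le ⟨_, g.2.add h.2⟩ <|
    X.enrm_add_le g.2.1.aemeasurable h.2.1.aemeasurable

theorem newtonNorm_add_le (hu : AEMeasurable u μ) (hv : AEMeasurable v μ) :
    X.newtonNorm (fun x => u x + v x) ≤ X.c * (X.newtonNorm u + X.newtonNorm v) := by
  simp only [newtonNorm_eq_nrm_add_gradientNorm]
  refine (add_le_add (X.nrm_add_le u v hu hv) gradientNorm_add_le).trans_eq ?_
  ring

theorem MemNewton.add (hu : X.MemNewton u) (hv : X.MemNewton v) :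
    X.MemNewton fun x => u x + v x :=
  ⟨hu.1.add hv.1, (newtonNorm_add_le hu.1 hv.1).trans_lt <|
    ENNReal.mul_lt_top ENNReal.coe_lt_top (ENNReal.add_lt_top.2 ⟨hu.2, hv.2⟩)⟩

theorem newtonNorm_mono (hv : AEMeasurable v μ) (hu : AEMeasurable u μ)
    (habs : ∀ x, (v x).abs ≤ (u x).abs) (hsub : ∀ x y, (v x - v y).abs ≤ (u x - u y).abs) :
    X.newtonNorm v ≤ X.newtonNorm u :=
  add_le_add (X.nrm_mono v u hv hu (ae_of_all _ habs)) <|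
    le_iInf₂ fun _ hg => gradientNorm_le (hg.mono_abs_sub hsub)

theorem MemNewton.neg (hu : X.MemNewton u) : X.MemNewton fun x => -u x :=
  ⟨hu.1.neg, (newtonNorm_mono hu.1.neg hu.1 (fun _ => (EReal.abs_neg _).le)
    fun _ _ => ereal_abs_neg_sub_neg_le _ _).trans_lt hu.2⟩

theorem gradientNorm_le_mul_enrm_indicator {g : P → ℝ≥0∞} (hg : Measurable g)
    (hgfin : X.enrm g < ∞) {K : ℝ≥0} (hu : IsUpperGradient u (fun x => g x + K)) {E : Set P}
    (hE : NullMeasurableSet E μ) (hzero : ∀ x ∉ E, u x = 0) :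
    X.gradientNorm u ≤ X.c * X.enrm (E.indicator fun x => g x + K) := by
  let F := toMeasurable μ E
  have hF : MeasurableSet F := measurableSet_toMeasurable μ E
  have hFE : F =ᵐ[μ] E := hE.toMeasurable_ae_eq
  have hgK : Measurable fun x => g x + (K : ℝ≥0∞) := hg.add_const _
  have hbound : ∀ δ : ℝ≥0, δ ≠ 0 → X.gradientNorm u ≤
      X.c * (X.enrm (E.indicator fun x => g x + K) + δ * X.enrm g) := by
    intro δ hδ
    calc X.gradientNorm u
        ≤ X.enrm (fun x => F.indicator (fun x => g x + K) x + δ * g x) :=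
          gradientNorm_le <| hu.indicator_add_const_mul hδ hg hF fun x hx =>
            hzero x (notMem_subset (subset_toMeasurable μ E) hx)
      _ ≤ X.c * (X.enrm (F.indicator fun x => g x + K) + X.enrm (fun x => δ * g x)) :=
          X.enrm_add_le (hgK.indicator hF).aemeasurable (hg.const_mul _).aemeasurable
      _ ≤ X.c * (X.enrm (E.indicator fun x => g x + K) + δ * X.enrm g) := by
          rw [X.enrm_const_mul δ hg.aemeasurable]
          gcongr
          exact X.enrm_mono (hgK.indicator hF).aemeasurable (hgK.aemeasurable.indicator₀ hE)
            (indicator_ae_eq_of_ae_eq_set hFE).le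
  have hlim : Tendsto (fun δ : ℝ≥0 =>
      (X.c : ℝ≥0∞) * (X.enrm (E.indicator fun x => g x + K) + δ * X.enrm g)) (𝓝[≠] 0)
      (𝓝 (X.c * (X.enrm (E.indicator fun x => g x + K) + (0 : ℝ≥0) * X.enrm g))) := by
    refine ENNReal.Tendsto.const_mul (tendsto_const_nhds.add ?_) (Or.inr ENNReal.coe_ne_top)
    exact ENNReal.Tendsto.mul_const (ENNReal.tendsto_coe.2 nhdsWithin_le_nhds) (Or.inr hgfin.ne)
  rw [ENNReal.coe_zero, zero_mul, add_zero] at hlim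
  exact ge_of_tendsto hlim (eventually_mem_nhdsWithin.mono hbound)

end NewtonNorm

end QuasiBanachFunctionLattice

section Truncation

/-- Truncation of real numbers at the levels `±τ`, the real-valued counterpart of `truncation`. -/
noncomputable def clamp (τ t : ℝ) : ℝ := max (min t τ) (-τ)

theorem lipschitzWith_clamp (τ : ℝ) : LipschitzWith 1 (clamp τ) :=
  (LipschitzWith.id.min_const τ).max_const (-τ)

theorem abs_clamp_le {τ : ℝ} (hτ : 0 ≤ τ) (t : ℝ) : |clamp τ t| ≤ τ :=
  abs_le.2 ⟨le_max_right _ _, max_le (min_le_right _ _) (by linarith)⟩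

theorem abs_clamp_le_abs {τ : ℝ} (hτ : 0 ≤ τ) (t : ℝ) : |clamp τ t| ≤ |t| := by
  simp only [clamp]
  grind

theorem clamp_eq_self {τ t : ℝ} (ht : |t| ≤ τ) : clamp τ t = t := by
  rw [abs_le] at ht
  rw [clamp, min_eq_left ht.2, max_eq_left ht.1]

theorem abs_sub_clamp_le {τ : ℝ} (hτ : 0 ≤ τ) (t : ℝ) : |t - clamp τ t| ≤ |t| := by
  simp only [clamp]
  grind

theorem lipschitzWith_sub_clamp {τ : ℝ} (hτ : 0 ≤ τ) : LipschitzWith 1 fun t => t - clamp τ t := by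
  refine LipschitzWith.of_dist_le_mul fun s t => ?_
  rw [NNReal.coe_one, one_mul, Real.dist_eq, Real.dist_eq]
  simp only [clamp]
  grind

variable {P : Type*} {u : P → EReal} {τ : ℝ} {x : P}

theorem truncation_of_eq_coe {t : ℝ} (h : u x = t) : truncation u τ x = (clamp τ t : ℝ) := by
  rw [truncation, h, clamp, EReal.coe_strictMono.monotone.map_max,
    EReal.coe_strictMono.monotone.map_min, EReal.coe_neg]

theorem exists_truncation_eq_coe (hτ : 0 ≤ τ) (x : P) :
    ∃ a : ℝ, |a| ≤ τ ∧ truncation u τ x = a := by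
  have hle : (-τ : EReal) ≤ τ := by
    rw [← EReal.coe_neg, EReal.coe_le_coe_iff]
    linarith
  induction h : u x with
  | coe t => exact ⟨clamp τ t, abs_clamp_le hτ t, truncation_of_eq_coe h⟩
  | top =>
    refine ⟨τ, (abs_of_nonneg hτ).le, ?_⟩
    rw [truncation, h, min_eq_right le_top, max_eq_left hle]
  | bot =>
    refine ⟨-τ, by rw [abs_neg, abs_of_nonneg hτ], ?_⟩
    rw [truncation, h, min_eq_left bot_le, max_eq_right bot_le, EReal.coe_neg]

theorem abs_truncation_le (hτ : 0 ≤ τ) (x : P) : (truncation u τ x).abs ≤ (u x).abs := by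
  obtain h | ⟨t, ht⟩ := ereal_abs_eq_top_or_exists_coe (u x)
  · simp [h]
  · rw [truncation_of_eq_coe ht, ht, EReal.abs_def, EReal.abs_def]
    exact ENNReal.ofReal_le_ofReal (abs_clamp_le_abs hτ t)

theorem abs_truncation_sub_le (τ : ℝ) (x y : P) :
    (truncation u τ x - truncation u τ y).abs ≤ (u x - u y).abs := by
  obtain h | ⟨a, b, ha, hb⟩ := ereal_abs_sub_eq_top_or_exists_coe (u x) (u y)
  · simp [h]
  · rw [truncation_of_eq_coe ha, truncation_of_eq_coe hb, ha, hb, ereal_abs_coe_sub_coe,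
      ereal_abs_coe_sub_coe]
    simpa using lipschitzWith_clamp τ a b

theorem abs_sub_truncation_le (hτ : 0 ≤ τ) (x : P) :
    (u x - truncation u τ x).abs ≤ (u x).abs := by
  obtain h | ⟨t, ht⟩ := ereal_abs_eq_top_or_exists_coe (u x)
  · simp [h]
  · rw [truncation_of_eq_coe ht, ht, ← EReal.coe_sub, EReal.abs_def, EReal.abs_def]
    exact ENNReal.ofReal_le_ofReal (abs_sub_clamp_le hτ t)

theorem abs_sub_truncation_sub_le (hτ : 0 ≤ τ) (x y : P) :
    ((u x - truncation u τ x) - (u y - truncation u τ y)).abs ≤ (u x - u y).abs := by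
  obtain h | ⟨a, b, ha, hb⟩ := ereal_abs_sub_eq_top_or_exists_coe (u x) (u y)
  · simp [h]
  · rw [truncation_of_eq_coe ha, truncation_of_eq_coe hb, ha, hb, ← EReal.coe_sub,
      ← EReal.coe_sub, ereal_abs_coe_sub_coe, ereal_abs_coe_sub_coe]
    simpa using lipschitzWith_sub_clamp hτ a b

theorem sub_truncation_eq_zero (hτ : 0 ≤ τ) (h : (u x).abs ≤ ENNReal.ofReal τ) :
    u x - truncation u τ x = 0 := by
  obtain htop | ⟨t, ht⟩ := ereal_abs_eq_top_or_exists_coe (u x)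
  · simp [htop] at h
  · rw [ht, EReal.abs_def, ENNReal.ofReal_le_ofReal_iff hτ] at h
    rw [truncation_of_eq_coe ht, ht, clamp_eq_self h, ← EReal.coe_sub, sub_self, EReal.coe_zero]

theorem aemeasurable_truncation [MeasurableSpace P] {μ : Measure P} (hu : AEMeasurable u μ)
    (τ : ℝ) : AEMeasurable (truncation u τ) μ :=
  (hu.min aemeasurable_const).max aemeasurable_const

theorem aemeasurable_ereal_sub [MeasurableSpace P] {μ : Measure P} {v : P → EReal}
    (hu : AEMeasurable u μ) (hv : AEMeasurable v μ) : AEMeasurable (fun x => u x - v x) μ := by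
  simp only [sub_eq_add_neg]
  exact hu.add hv.neg

end Truncation

namespace QuasiBanachFunctionLattice

variable {P : Type*} [PseudoEMetricSpace P] [MeasurableSpace P] {μ : Measure P}
  {X : QuasiBanachFunctionLattice μ} {u : P → EReal}

theorem MemNewton.truncation (hu : X.MemNewton u) {τ : ℝ} (hτ : 0 ≤ τ) :
    X.MemNewton (truncation u τ) :=
  ⟨aemeasurable_truncation hu.1 τ, (newtonNorm_mono (aemeasurable_truncation hu.1 τ) hu.1
    (abs_truncation_le hτ) (abs_truncation_sub_le τ)).trans_lt hu.2⟩

theorem tendsto_newtonNorm_sub_truncation (hX : X.AbsolutelyContinuousNorm) (hu : X.MemNewton u) :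
    Tendsto (fun n : ℕ => X.newtonNorm fun x => u x - truncation u n x) atTop (𝓝 0) := by
  obtain ⟨g, hg, hgfin⟩ := hu.exists_isUpperGradient
  have hua : AEMeasurable (fun x => (u x).abs) μ := measurable_ereal_abs.comp_aemeasurable hu.1
  have hufin : X.enrm (fun x => (u x).abs) < ∞ := X.nrm_eq_enrm_abs hu.1 ▸ hu.mem.2
  let E (n : ℕ) : Set P := {x | (n : ℝ≥0∞) < (u x).abs}
  have hE (n : ℕ) : NullMeasurableSet (E n) μ := nullMeasurableSet_lt aemeasurable_const hua
  have hanti : Antitone E := fun a b hab x (hx : (b : ℝ≥0∞) < (u x).abs) =>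
    (Nat.cast_le.2 hab : (a : ℝ≥0∞) ≤ b).trans_lt hx
  have hnull : μ (⋂ n, E n) = 0 :=
    measure_iInter_eq_zero_of_tendsto_enrm hE hu.mem.tendsto_enrm_indicator_abs_gt
  have hzero (n : ℕ) : ∀ x ∉ E n, u x - truncation u n x = 0 := fun x hx =>
    sub_truncation_eq_zero n.cast_nonneg (by simpa [E] using hx)
  have hbound (n : ℕ) : X.newtonNorm (fun x => u x - truncation u n x) ≤
      X.enrm ((E n).indicator fun x => (u x).abs) + X.c * X.enrm ((E n).indicator g) := by
    have hgrad : IsUpperGradient (fun x => u x - truncation u n x) (fun x => g x + (0 : ℝ≥0)) := by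
      simpa using hg.mono_abs_sub (abs_sub_truncation_sub_le n.cast_nonneg)
    have hgradnorm := gradientNorm_le_mul_enrm_indicator hg.1 hgfin hgrad (hE n) (hzero n)
    simp only [ENNReal.coe_zero, add_zero] at hgradnorm
    refine add_le_add ?_ hgradnorm
    refine X.nrm_le_enrm (aemeasurable_ereal_sub hu.1 (aemeasurable_truncation hu.1 n))
      (hua.indicator₀ (hE n)) (ae_of_all _ fun x => ?_)
    by_cases hx : x ∈ E n
    · rw [indicator_of_mem hx]
      exact abs_sub_truncation_le n.cast_nonneg x
    · simp [hzero n x hx]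
  have hlim : Tendsto (fun n => X.enrm ((E n).indicator fun x => (u x).abs) +
      X.c * X.enrm ((E n).indicator g)) atTop (𝓝 0) := by
    simpa using (hX.tendsto_enrm_indicator hua hufin hE hanti hnull).add <|
      ENNReal.Tendsto.const_mul (hX.tendsto_enrm_indicator hg.1.aemeasurable hgfin hE hanti hnull)
        (Or.inr ENNReal.coe_ne_top)
  exact tendsto_of_tendsto_of_tendsto_of_le_of_le tendsto_const_nhds hlim (fun _ => zero_le) hbound

end QuasiBanachFunctionLattice

section Averages

variable {α : Type*} [MeasurableSpace α] {μ : Measure α} {s t : Set α}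
  {E F : Type*} [NormedAddCommGroup E] [NormedAddCommGroup F]

theorem integrableOn_norm_sub_const {f : α → E} (hs : μ s ≠ ∞) (hf : IntegrableOn f s μ) (a : E) :
    IntegrableOn (fun y => ‖f y - a‖) s μ :=
  (hf.sub (integrableOn_const hs)).norm

theorem integrableOn_comp_of_lipschitzWith {f : α → E} {φ : E → F} {K : ℝ≥0}
    (hφ : LipschitzWith K φ) (hs : μ s ≠ ∞) (hf : IntegrableOn f s μ) :
    IntegrableOn (fun y => φ (f y)) s μ := by
  have hbound : IntegrableOn (fun y => K * ‖f y‖ + ‖φ 0‖) s μ :=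
    (hf.norm.const_mul _).add (integrableOn_const hs)
  refine Integrable.mono' hbound (hφ.continuous.comp_aestronglyMeasurable hf.1)
    (ae_of_all _ fun y => ?_)
  calc ‖φ (f y)‖ ≤ ‖φ (f y) - φ 0‖ + ‖φ 0‖ := norm_le_norm_sub_add _ _
    _ ≤ K * ‖f y‖ + ‖φ 0‖ := by
      gcongr
      simpa using hφ.norm_sub_le (f y) 0

variable [NormedSpace ℝ E] [NormedSpace ℝ F]

theorem setAverage_mono {f g : α → ℝ} (hf : IntegrableOn f s μ) (hg : IntegrableOn g s μ)
    (hfg : ∀ y, f y ≤ g y) : ⨍ y in s, f y ∂μ ≤ ⨍ y in s, g y ∂μ :=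
  integral_mono hf.to_average hg.to_average hfg

theorem norm_setAverage_sub_le [CompleteSpace E] {f : α → E} (h0 : μ s ≠ 0) (hs : μ s ≠ ∞)
    (hf : IntegrableOn f s μ) (a : E) :
    ‖(⨍ y in s, f y ∂μ) - a‖ ≤ ⨍ y in s, ‖f y - a‖ ∂μ := by
  have hconst : IntegrableOn (fun _ => a) s μ := integrableOn_const hs
  have hsub : ⨍ y in s, (f y - a) ∂μ = (⨍ y in s, f y ∂μ) - a := by
    conv_rhs => rw [← setAverage_const h0 hs a]
    exact integral_sub hf.to_average hconst.to_average
  rw [← hsub]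
  exact norm_integral_le_integral_norm _

theorem setAverage_le_mul_setAverage {f : α → ℝ} (hst : s ⊆ t) (h0 : μ s ≠ 0) (ht : μ t ≠ ∞)
    {D : ℝ≥0} (hD : μ t ≤ D * μ s) (hf : IntegrableOn f t μ) (hf0 : 0 ≤ f) :
    ⨍ y in s, f y ∂μ ≤ D * ⨍ y in t, f y ∂μ := by
  have hs : 0 < μ.real s := ENNReal.toReal_pos h0 (measure_ne_top_of_subset hst ht)
  have ht' : 0 < μ.real t := hs.trans_le (measureReal_mono hst ht)
  have hDr : μ.real t ≤ D * μ.real s := by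
    simpa [measureReal_def] using
      ENNReal.toReal_mono (ENNReal.mul_ne_top ENNReal.coe_ne_top
        (measure_ne_top_of_subset hst ht)) hD
  rw [setAverage_eq, setAverage_eq, smul_eq_mul, smul_eq_mul, ← mul_assoc]
  refine mul_le_mul ?_ (setIntegral_mono_set hf (ae_of_all _ hf0) hst.eventuallyLE)
    (integral_nonneg hf0) (by positivity)
  rw [inv_le_iff_one_le_mul₀ hs]
  calc (1 : ℝ) = (μ.real t)⁻¹ * μ.real t := (inv_mul_cancel₀ ht'.ne').symm
    _ ≤ (μ.real t)⁻¹ * (D * μ.real s) := by gcongr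
    _ = D * (μ.real t)⁻¹ * μ.real s := by ring

/-- The mean oscillation `⨍_s ‖f - f_s‖ dμ` of `f` over `s`, where `f_s = ⨍_s f dμ`. -/
noncomputable def meanOscillation (μ : Measure α) (f : α → E) (s : Set α) : ℝ :=
  ⨍ y in s, ‖f y - ⨍ z in s, f z ∂μ‖ ∂μ

theorem norm_setAverage_sub_setAverage_le [CompleteSpace E] {f : α → E} (hst : s ⊆ t)
    (h0 : μ s ≠ 0) (ht : μ t ≠ ∞) {D : ℝ≥0} (hD : μ t ≤ D * μ s) (hf : IntegrableOn f t μ) :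
    ‖(⨍ y in s, f y ∂μ) - ⨍ y in t, f y ∂μ‖ ≤ D * meanOscillation μ f t :=
  (norm_setAverage_sub_le h0 (measure_ne_top_of_subset hst ht) (hf.mono_set hst) _).trans <|
    setAverage_le_mul_setAverage hst h0 ht hD (integrableOn_norm_sub_const ht hf _)
      fun _ => norm_nonneg _

theorem meanOscillation_comp_le [CompleteSpace F] {f : α → E} {φ : E → F} {K : ℝ≥0}
    (hφ : LipschitzWith K φ) (h0 : μ s ≠ 0) (hs : μ s ≠ ∞) (hf : IntegrableOn f s μ) :
    meanOscillation μ (fun y => φ (f y)) s ≤ 2 * K * meanOscillation μ f s := by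
  let m := ⨍ z in s, f z ∂μ
  let M := ⨍ z in s, φ (f z) ∂μ
  have hφf := integrableOn_comp_of_lipschitzWith hφ hs hf
  have hfi := integrableOn_norm_sub_const hs hφf (φ m)
  have hcomp : ⨍ y in s, ‖φ (f y) - φ m‖ ∂μ ≤ K * meanOscillation μ f s := by
    refine (setAverage_mono hfi ((integrableOn_norm_sub_const hs hf m).const_mul K)
      fun y => hφ.norm_sub_le _ _).trans_eq ?_
    exact integral_const_mul _ _
  calc meanOscillation μ (fun y => φ (f y)) s
      ≤ ⨍ y in s, (‖φ (f y) - φ m‖ + ‖φ m - M‖) ∂μ :=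
        setAverage_mono (integrableOn_norm_sub_const hs hφf M)
          (hfi.add (integrableOn_const hs (C := ‖φ m - M‖))) fun y =>
            norm_sub_le_norm_sub_add_norm_sub _ _ _
    _ = (⨍ y in s, ‖φ (f y) - φ m‖ ∂μ) + ‖M - φ m‖ := by
        conv_rhs => rw [norm_sub_rev M, ← setAverage_const h0 hs ‖φ m - M‖]
        exact integral_add hfi.to_average (integrableOn_const hs (C := ‖φ m - M‖)).to_average
    _ ≤ (⨍ y in s, ‖φ (f y) - φ m‖ ∂μ) + ⨍ y in s, ‖φ (f y) - φ m‖ ∂μ := by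
        gcongr
        exact norm_setAverage_sub_le h0 hs hφf _
    _ ≤ K * meanOscillation μ f s + K * meanOscillation μ f s := add_le_add hcomp hcomp
    _ = 2 * K * meanOscillation μ f s := by ring

section ExhaustingSets

variable {ι : Type*} {l : Filter ι} [l.IsCountablyGenerated] {S : ι → Set α}

theorem tendsto_setIntegral_of_dominated (hS : ∀ᶠ i in l, MeasurableSet (S i))
    (hst : ∀ᶠ i in l, S i ⊆ t) (hmem : ∀ y ∈ t, ∀ᶠ i in l, y ∈ S i) (ht : MeasurableSet t)
    {G : ι → α → E} {f : α → E} {bound : α → ℝ}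
    (hG : ∀ᶠ i in l, AEStronglyMeasurable (G i) (μ.restrict t)) (hbound : IntegrableOn bound t μ)
    (hle : ∀ᶠ i in l, ∀ y ∈ t, ‖G i y‖ ≤ bound y) (hlim : ∀ y ∈ t, Tendsto (G · y) l (𝓝 (f y))) :
    Tendsto (fun i => ∫ y in S i, G i y ∂μ) l (𝓝 (∫ y in t, f y ∂μ)) := by
  have hdom : Tendsto (fun i => ∫ y in t, (S i).indicator (G i) y ∂μ) l
      (𝓝 (∫ y in t, f y ∂μ)) := by
    refine tendsto_integral_filter_of_dominated_convergence bound ?_ ?_ hbound ?_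
    · filter_upwards [hS, hG] with i hSi hGi using hGi.indicator hSi
    · filter_upwards [hle] with i hi
      filter_upwards [ae_restrict_mem ht] with y hy
      exact (norm_indicator_le_norm_self _ _).trans (hi y hy)
    · filter_upwards [ae_restrict_mem ht] with y hy
      refine (hlim y hy).congr' ?_
      filter_upwards [hmem y hy] with i hi using (indicator_of_mem hi _).symm
  refine hdom.congr' ?_
  filter_upwards [hS, hst] with i hSi hsti
  rw [integral_indicator hSi, Measure.restrict_restrict_of_subset hsti]

theorem tendsto_setAverage_of_dominated (hS : ∀ᶠ i in l, MeasurableSet (S i))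
    (hst : ∀ᶠ i in l, S i ⊆ t) (hmem : ∀ y ∈ t, ∀ᶠ i in l, y ∈ S i) (ht : MeasurableSet t)
    (h0 : μ t ≠ 0) (hfin : μ t ≠ ∞) {G : ι → α → E} {f : α → E} {bound : α → ℝ}
    (hG : ∀ᶠ i in l, AEStronglyMeasurable (G i) (μ.restrict t)) (hbound : IntegrableOn bound t μ)
    (hle : ∀ᶠ i in l, ∀ y ∈ t, ‖G i y‖ ≤ bound y) (hlim : ∀ y ∈ t, Tendsto (G · y) l (𝓝 (f y))) :
    Tendsto (fun i => ⨍ y in S i, G i y ∂μ) l (𝓝 (⨍ y in t, f y ∂μ)) := by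
  have hmeasure : Tendsto (fun i => μ.real (S i)) l (𝓝 (μ.real t)) := by
    have hone := tendsto_setIntegral_of_dominated hS hst hmem ht (μ := μ) (G := fun _ _ => (1 : ℝ))
      (Eventually.of_forall fun _ => aestronglyMeasurable_const)
      (integrableOn_const hfin (C := (1 : ℝ))) (by simp) (fun _ _ => tendsto_const_nhds)
    simpa using hone
  simp only [setAverage_eq]
  exact (hmeasure.inv₀ (ENNReal.toReal_pos h0 hfin).ne').smul
    (tendsto_setIntegral_of_dominated hS hst hmem ht hG hbound hle hlim)

theorem tendsto_meanOscillation (hS : ∀ᶠ i in l, MeasurableSet (S i))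
    (hst : ∀ᶠ i in l, S i ⊆ t) (hmem : ∀ y ∈ t, ∀ᶠ i in l, y ∈ S i) (ht : MeasurableSet t)
    (h0 : μ t ≠ 0) (hfin : μ t ≠ ∞) {f : α → E} (hf : IntegrableOn f t μ) :
    Tendsto (fun i => meanOscillation μ f (S i)) l (𝓝 (meanOscillation μ f t)) := by
  have hmean : Tendsto (fun i => ⨍ y in S i, f y ∂μ) l (𝓝 (⨍ y in t, f y ∂μ)) :=
    tendsto_setAverage_of_dominated hS hst hmem ht h0 hfin (Eventually.of_forall fun _ => hf.1)
      hf.norm (Eventually.of_forall fun _ _ _ => le_rfl) fun _ _ => tendsto_const_nhds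
  have hbound : IntegrableOn (fun y => ‖f y‖ + (‖⨍ y in t, f y ∂μ‖ + 1)) t μ :=
    hf.norm.add (integrableOn_const hfin)
  refine tendsto_setAverage_of_dominated hS hst hmem ht h0 hfin
    (Eventually.of_forall fun i => (integrableOn_norm_sub_const hfin hf _).1) hbound ?_
    fun y _ => (tendsto_const_nhds.sub hmean).norm
  filter_upwards [hmean.norm.eventually_le_const (lt_add_one _)] with i hi y _
  rw [norm_norm]
  exact (norm_sub_le _ _).trans (by gcongr)

end ExhaustingSets

end Averages

section BallsOfFinitePositiveMeasure

variable {P : Type*} [PseudoMetricSpace P] [MeasurableSpace P] {μ : Measure P}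

/-- Every ball has finite positive measure. -/
def BallsFinitePos (μ : Measure P) : Prop :=
  ∀ (x : P) (r : ℝ), 0 < r → 0 < μ (Metric.ball x r) ∧ μ (Metric.ball x r) < ∞

theorem BallsFinitePos.measure_ball_ne_zero (hμ : BallsFinitePos μ) (x : P) {r : ℝ} (hr : 0 < r) :
    μ (Metric.ball x r) ≠ 0 :=
  (hμ x r hr).1.ne'

theorem BallsFinitePos.measure_ball_ne_top (hμ : BallsFinitePos μ) (x : P) (r : ℝ) :
    μ (Metric.ball x r) ≠ ∞ := by
  rcases lt_or_ge 0 r with hr | hr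
  · exact (hμ x r hr).2.ne
  · simp [Metric.ball_eq_empty.2 hr]

theorem BallsFinitePos.sigmaFinite (hμ : BallsFinitePos μ) : SigmaFinite μ := by
  rcases isEmpty_or_nonempty P with _ | ⟨⟨x⟩⟩
  · rw [μ.eq_zero_of_isEmpty]
    infer_instance
  · exact ⟨⟨{
      set := fun n => Metric.ball x n
      set_mem := fun _ => mem_univ _
      finite := fun n => (hμ.measure_ball_ne_top x n).lt_top
      spanning := Metric.iUnion_ball_nat x }⟩⟩

theorem BallsFinitePos.integrableOn_of_norm_le {E : Type*} [NormedAddCommGroup E] {f : P → E}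
    (hμ : BallsFinitePos μ) (hf : AEStronglyMeasurable f μ) {M : ℝ} (hM : ∀ x, ‖f x‖ ≤ M)
    (x : P) (r : ℝ) : IntegrableOn f (Metric.ball x r) μ :=
  Measure.integrableOn_of_bounded (hμ.measure_ball_ne_top x r) hf (ae_of_all _ hM)

theorem secondCountableTopology_of_measure_ball_pos [OpensMeasurableSpace P] [SFinite μ]
    (hμ : ∀ (x : P) (r : ℝ), 0 < r → 0 < μ (Metric.ball x r)) : SecondCountableTopology P := by
  refine Metric.secondCountable_of_almost_dense_set fun ε hε => ?_
  obtain ⟨s, -, hdisj, hcov⟩ := Vitali.exists_disjoint_subfamily_covering_enlargement_closedBall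
    (univ : Set P) id (fun _ => ε / 5) (ε / 5) (fun _ _ => le_rfl) 5 (by norm_num)
  refine ⟨s, ?_, fun x => ?_⟩
  · have hcount := Measure.countable_meas_pos_of_disjoint_iUnion (μ := μ)
      (As := fun x : s => Metric.closedBall (x : P) (ε / 5))
      (fun _ => Metric.isClosed_closedBall.measurableSet)
      (fun x y hxy => hdisj x.2 y.2 (Subtype.coe_injective.ne hxy))
    have huniv : {x : s | 0 < μ (Metric.closedBall (x : P) (ε / 5))} = univ :=
      eq_univ_of_forall fun x => (hμ x _ (by positivity)).trans_le
        (measure_mono Metric.ball_subset_closedBall)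
    rw [huniv] at hcount
    exact countable_coe_iff.1 (countable_univ_iff.1 hcount)
  · obtain ⟨y, hy, hsub⟩ := hcov x (mem_univ x)
    have hdist := hsub (Metric.mem_closedBall_self (by positivity))
    rw [Metric.mem_closedBall] at hdist
    exact ⟨y, hy, by simpa [mul_div_cancel₀] using hdist⟩

/-- Doubling on balls with constant `C`; unlike in `IsUnifLocDoublingMeasure`, at all radii. -/
def IsDoublingOnBalls (μ : Measure P) (C : ℝ≥0) : Prop :=
  ∀ (x : P) (r : ℝ), 0 < r → μ (Metric.ball x (2 * r)) ≤ C * μ (Metric.ball x r)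

variable {C : ℝ≥0}

theorem IsDoublingOnBalls.measure_closedBall_le (hC : IsDoublingOnBalls μ C) (x : P) {r : ℝ}
    (hr : 0 < r) : μ (Metric.closedBall x r) ≤ C * μ (Metric.ball x r) :=
  (measure_mono (Metric.closedBall_subset_ball (by linarith))).trans (hC x r hr)

theorem IsDoublingOnBalls.isUnifLocDoublingMeasure (hC : IsDoublingOnBalls μ C) :
    IsUnifLocDoublingMeasure μ := by
  refine ⟨⟨C * C, ?_⟩⟩
  filter_upwards [self_mem_nhdsWithin] with r (hr : 0 < r) x
  calc μ (Metric.closedBall x (2 * r))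
      ≤ C * μ (Metric.ball x (2 * r)) := hC.measure_closedBall_le x (by positivity)
    _ ≤ C * (C * μ (Metric.ball x r)) := by gcongr; exact hC x r hr
    _ ≤ C * (C * μ (Metric.closedBall x r)) := by gcongr; exact Metric.ball_subset_closedBall
    _ = (C * C : ℝ≥0) * μ (Metric.closedBall x r) := by rw [← mul_assoc, ENNReal.coe_mul]

end BallsOfFinitePositiveMeasure

section BallLebesguePoints

variable {P : Type*} [PseudoMetricSpace P] [MeasurableSpace P] {μ : Measure P} {C : ℝ≥0}
  {E : Type*} [NormedAddCommGroup E] [NormedSpace ℝ E] {f : P → E} {x y : P} {r σ : ℝ}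

/-- `x` is a Lebesgue point of `f` in the sense that the averages of `f` over the open balls centred
at `x` converge to `f x`. -/
def IsBallLebesguePoint (μ : Measure P) (f : P → E) (x : P) : Prop :=
  Tendsto (fun r => ⨍ y in Metric.ball x r, f y ∂μ) (𝓝[>] 0) (𝓝 (f x))

theorem ae_isBallLebesguePoint [CompleteSpace E] [BorelSpace P] (hμ : BallsFinitePos μ)
    (hC : IsDoublingOnBalls μ C) (hf : ∀ x r, IntegrableOn f (Metric.ball x r) μ) :
    ∀ᵐ x ∂μ, IsBallLebesguePoint μ f x := by
  have := hμ.sigmaFinite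
  have := secondCountableTopology_of_measure_ball_pos fun x r hr => (hμ x r hr).1
  have : IsLocallyFiniteMeasure μ := ⟨fun x => ⟨_, Metric.ball_mem_nhds x one_pos,
    (hμ.measure_ball_ne_top x 1).lt_top⟩⟩
  have := hC.isUnifLocDoublingMeasure
  have hloc : LocallyIntegrable f μ := fun x => ⟨_, Metric.ball_mem_nhds x one_pos, hf x 1⟩
  filter_upwards [IsUnifLocDoublingMeasure.ae_tendsto_average_norm_sub μ hloc 1] with x hx
  have hclosed : Tendsto (fun r => ⨍ y in Metric.closedBall x r, ‖f y - f x‖ ∂μ) (𝓝[>] 0) (𝓝 0) :=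
    hx (fun _ => x) id tendsto_id <| eventually_mem_nhdsWithin.mono fun r (hr : 0 < r) =>
      Metric.mem_closedBall_self (by simpa using hr.le)
  rw [IsBallLebesguePoint, tendsto_iff_norm_sub_tendsto_zero]
  refine squeeze_zero' (Eventually.of_forall fun _ => norm_nonneg _) ?_
    (by simpa using hclosed.const_mul (C : ℝ))
  filter_upwards [self_mem_nhdsWithin] with r (hr : 0 < r)
  have hsub : Metric.closedBall x r ⊆ Metric.ball x (2 * r) :=
    Metric.closedBall_subset_ball (by linarith)
  have hfin : μ (Metric.closedBall x r) ≠ ∞ :=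
    measure_ne_top_of_subset hsub (hμ.measure_ball_ne_top x _)
  exact (norm_setAverage_sub_le (hμ.measure_ball_ne_zero x hr) (hμ.measure_ball_ne_top x r)
    (hf x r) _).trans <| setAverage_le_mul_setAverage Metric.ball_subset_closedBall
      (hμ.measure_ball_ne_zero x hr) hfin (hC.measure_closedBall_le x hr)
      (integrableOn_norm_sub_const hfin ((hf x _).mono_set hsub) _) fun _ => norm_nonneg _

variable [CompleteSpace E]

theorem norm_setAverage_ball_sub_setAverage_ball_le (hμ : BallsFinitePos μ)
    (hf : ∀ x r, IntegrableOn f (Metric.ball x r) μ) {s : ℝ} (hs : 0 < s)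
    (hsub : Metric.ball y s ⊆ Metric.ball x r) {D : ℝ≥0}
    (hD : μ (Metric.ball x r) ≤ D * μ (Metric.ball y s))
    (hosc : meanOscillation μ f (Metric.ball x r) ≤ r * σ) :
    ‖(⨍ z in Metric.ball y s, f z ∂μ) - ⨍ z in Metric.ball x r, f z ∂μ‖ ≤ D * (r * σ) :=
  (norm_setAverage_sub_setAverage_le hsub (hμ.measure_ball_ne_zero y hs)
    (hμ.measure_ball_ne_top x r) hD (hf x r)).trans (by gcongr)

-- Telescoping over the balls `B(x, r / 2 ^ i)`, whose oscillations are summable.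
theorem IsBallLebesguePoint.norm_setAverage_sub_le (hμ : BallsFinitePos μ)
    (hC : IsDoublingOnBalls μ C) (hf : ∀ x r, IntegrableOn f (Metric.ball x r) μ)
    (hx : IsBallLebesguePoint μ f x)
    (hosc : ∀ r, 0 < r → meanOscillation μ f (Metric.ball x r) ≤ r * σ) (hr : 0 < r) :
    ‖(⨍ y in Metric.ball x r, f y ∂μ) - f x‖ ≤ 2 * C * r * σ := by
  have hstep (i : ℕ) : dist (⨍ y in Metric.ball x (r / 2 ^ i), f y ∂μ)
      (⨍ y in Metric.ball x (r / 2 ^ (i + 1)), f y ∂μ) ≤ 2 * C * r * σ / 2 / 2 ^ i := by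
    have hhalf : r / 2 ^ i = 2 * (r / 2 ^ (i + 1)) := by rw [pow_succ]; field_simp
    have hpos : 0 < r / 2 ^ (i + 1) := by positivity
    rw [dist_comm, dist_eq_norm]
    refine (norm_setAverage_ball_sub_setAverage_ball_le hμ hf hpos
      (Metric.ball_subset_ball (by linarith)) (by rw [hhalf]; exact hC x _ hpos)
      (hosc _ (by positivity))).trans_eq ?_
    ring
  have hradii : Tendsto (fun i : ℕ => r / 2 ^ i) atTop (𝓝[>] 0) :=
    tendsto_nhdsWithin_iff.2 ⟨tendsto_const_nhds.div_atTop
      (tendsto_pow_atTop_atTop_of_one_lt one_lt_two), Eventually.of_forall fun i => by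
        simp only [mem_Ioi]; positivity⟩
  have hlim := dist_le_of_le_geometric_two_of_tendsto₀ hstep (hx.comp hradii)
  rwa [pow_zero, div_one, dist_eq_norm] at hlim

theorem IsBallLebesguePoint.norm_sub_le (hμ : BallsFinitePos μ) (hC : IsDoublingOnBalls μ C)
    (hf : ∀ x r, IntegrableOn f (Metric.ball x r) μ)
    (hx : IsBallLebesguePoint μ f x) (hy : IsBallLebesguePoint μ f y)
    (hoscx : ∀ r, 0 < r → meanOscillation μ f (Metric.ball x r) ≤ r * σ)
    (hoscy : ∀ r, 0 < r → meanOscillation μ f (Metric.ball y r) ≤ r * σ)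
    (hr : 0 < r) (hxy : dist x y ≤ r) :
    ‖f x - f y‖ ≤ (6 * C + 2 * C ^ 2) * σ * r := by
  have hD : μ (Metric.ball x (2 * r)) ≤ (C ^ 2 : ℝ≥0) * μ (Metric.ball y r) :=
    calc μ (Metric.ball x (2 * r)) ≤ μ (Metric.ball y (2 * (2 * r))) :=
          measure_mono (Metric.ball_subset_ball' (by linarith))
      _ ≤ C * μ (Metric.ball y (2 * r)) := hC _ _ (by positivity)
      _ ≤ C * (C * μ (Metric.ball y r)) := by gcongr; exact hC _ _ hr
      _ = (C ^ 2 : ℝ≥0) * μ (Metric.ball y r) := by rw [← mul_assoc, ← ENNReal.coe_mul, sq]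
  have hfx := hx.norm_setAverage_sub_le hμ hC hf hoscx (r := 2 * r) (by positivity)
  have hfy := hy.norm_setAverage_sub_le hμ hC hf hoscy hr
  have hmean := norm_setAverage_ball_sub_setAverage_ball_le hμ hf hr
    (Metric.ball_subset_ball' (by rw [dist_comm]; linarith)) hD (hoscx (2 * r) (by positivity))
  set mx := ⨍ z in Metric.ball x (2 * r), f z ∂μ
  set my := ⨍ z in Metric.ball y r, f z ∂μ
  calc ‖f x - f y‖ = ‖(my - f y) - (mx - f x) - (my - mx)‖ := by congr 1; abel
    _ ≤ ‖my - f y‖ + ‖mx - f x‖ + ‖my - mx‖ :=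
        (_root_.norm_sub_le _ _).trans (by gcongr; exact _root_.norm_sub_le _ _)
    _ ≤ 2 * C * r * σ + 2 * C * (2 * r) * σ + (C ^ 2 : ℝ≥0) * (2 * r * σ) := by gcongr
    _ = (6 * C + 2 * C ^ 2) * σ * r := by push_cast; ring

theorem lipschitzOnWith_setOf_meanOscillation_le (hμ : BallsFinitePos μ)
    (hC : IsDoublingOnBalls μ C) (hf : ∀ x r, IntegrableOn f (Metric.ball x r) μ) (σ : ℝ≥0) :
    LipschitzOnWith ((6 * C + 2 * C ^ 2) * σ) f {x | IsBallLebesguePoint μ f x ∧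
      ∀ r, 0 < r → meanOscillation μ f (Metric.ball x r) ≤ r * σ} := by
  refine LipschitzOnWith.of_dist_le_mul fun x hx y hy => ?_
  have hlim : Tendsto (fun r : ℝ => (6 * C + 2 * C ^ 2) * σ * r) (𝓝[>] dist x y)
      (𝓝 ((6 * C + 2 * C ^ 2) * σ * dist x y)) :=
    tendsto_const_nhds.mul nhdsWithin_le_nhds
  rw [dist_eq_norm]
  push_cast
  refine ge_of_tendsto hlim (eventually_mem_nhdsWithin.mono fun r (hr : dist x y < r) => ?_)
  exact hx.1.norm_sub_le hμ hC hf hy.1 hx.2 hy.2 (dist_nonneg.trans_lt hr) hr.le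

end BallLebesguePoints

section FractionalSharpMaximalFunction

variable {P : Type*} [PseudoMetricSpace P] [MeasurableSpace P] {μ : Measure P} {f : P → ℝ} {x : P}
  {σ : ℝ}

theorem fracSharp_congr {u v : P → EReal} (h : u =ᵐ[μ] v) : fracSharp μ u = fracSharp μ v := by
  funext x
  simp only [fracSharp]
  refine iSup_congr fun r => iSup_congr fun _ => ?_
  have hr : u =ᵐ[μ.restrict (Metric.ball x r)] v := ae_restrict_of_ae h
  have hmean : ⨍ z in Metric.ball x r, (u z).toReal ∂μ = ⨍ z in Metric.ball x r, (v z).toReal ∂μ :=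
    average_congr (hr.fun_comp EReal.toReal)
  rw [hmean, laverage_congr (hr.mono fun y hy => by rw [hy])]

theorem fracSharp_coe (hμ : BallsFinitePos μ) (hf : ∀ x r, IntegrableOn f (Metric.ball x r) μ)
    (x : P) : fracSharp μ (fun y => (f y : EReal)) x =
      ⨆ (r : ℝ) (_ : 0 < r), ENNReal.ofReal (r⁻¹ * meanOscillation μ f (Metric.ball x r)) := by
  simp only [fracSharp, ereal_abs_coe_sub_coe, EReal.toReal_coe]
  refine iSup_congr fun r => iSup_congr fun hr => ?_
  rw [ENNReal.ofReal_mul (inv_nonneg.2 hr.le), ENNReal.ofReal_inv_of_pos hr, meanOscillation,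
    ofReal_setAverage (integrableOn_norm_sub_const (hμ.measure_ball_ne_top x r) (hf x r) _)
      (ae_of_all _ fun _ => norm_nonneg _), setLAverage_eq]
  simp only [edist_dist, dist_eq_norm]

theorem lt_fracSharp_coe_iff (hμ : BallsFinitePos μ)
    (hf : ∀ x r, IntegrableOn f (Metric.ball x r) μ) (hσ : 0 ≤ σ) :
    ENNReal.ofReal σ < fracSharp μ (fun y => (f y : EReal)) x ↔
      ∃ r, 0 < r ∧ r * σ < meanOscillation μ f (Metric.ball x r) := by
  simp only [fracSharp_coe hμ hf, lt_iSup_iff, exists_prop]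
  refine exists_congr fun r => and_congr_right fun hr => ?_
  rw [ENNReal.ofReal_lt_ofReal_iff_of_nonneg hσ, lt_inv_mul_iff₀ hr]

theorem fracSharp_comp_le (hμ : BallsFinitePos μ) (hf : ∀ x r, IntegrableOn f (Metric.ball x r) μ)
    {φ : ℝ → ℝ} {K : ℝ≥0} (hφ : LipschitzWith K φ) (x : P) :
    fracSharp μ (fun y => (φ (f y) : EReal)) x ≤
      2 * K * fracSharp μ (fun y => (f y : EReal)) x := by
  have hφf (x : P) (r : ℝ) : IntegrableOn (fun y => φ (f y)) (Metric.ball x r) μ :=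
    integrableOn_comp_of_lipschitzWith hφ (hμ.measure_ball_ne_top x r) (hf x r)
  rw [fracSharp_coe hμ hφf, fracSharp_coe hμ hf]
  refine iSup₂_le fun r hr => le_trans ?_ (mul_le_mul_right (le_iSup₂ r hr) _)
  have hfactor : (2 * K : ℝ≥0∞) = ENNReal.ofReal (2 * K) := by
    rw [ENNReal.ofReal_mul zero_le_two, ENNReal.ofReal_ofNat, ENNReal.ofReal_coe_nnreal]
  rw [hfactor, ← ENNReal.ofReal_mul (by positivity), mul_left_comm]
  gcongr
  exact meanOscillation_comp_le hφ (hμ.measure_ball_ne_zero x hr) (hμ.measure_ball_ne_top x r)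
    (hf x r)

-- As `x'` tends to `x`, the balls `B(x', r - d(x', x)) ⊆ B(x, r)` exhaust `B(x, r)`.
theorem isOpen_setOf_lt_fracSharp [OpensMeasurableSpace P] (hμ : BallsFinitePos μ)
    (hf : ∀ x r, IntegrableOn f (Metric.ball x r) μ) (hσ : 0 ≤ σ) :
    IsOpen {x | ENNReal.ofReal σ < fracSharp μ (fun y => (f y : EReal)) x} := by
  rw [isOpen_iff_mem_nhds]
  intro x hx
  obtain ⟨r, hr, hosc⟩ := (lt_fracSharp_coe_iff hμ hf hσ).1 hx
  have hradius : Tendsto (fun x' => r - dist x' x) (𝓝 x) (𝓝 r) :=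
    Continuous.tendsto' (by fun_prop) _ _ (by simp)
  have hexhaust : ∀ y ∈ Metric.ball x r, ∀ᶠ x' in 𝓝 x, y ∈ Metric.ball x' (r - dist x' x) := by
    intro y hy
    have hdist : Tendsto (fun x' => dist y x') (𝓝 x) (𝓝 (dist y x)) :=
      Continuous.tendsto' (by fun_prop) _ _ rfl
    exact hdist.eventually_lt hradius hy
  have hlim : Tendsto (fun x' => meanOscillation μ f (Metric.ball x' (r - dist x' x))) (𝓝 x)
      (𝓝 (meanOscillation μ f (Metric.ball x r))) :=
    tendsto_meanOscillation (Eventually.of_forall fun _ => measurableSet_ball)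
      (Eventually.of_forall fun x' => Metric.ball_subset_ball' (by linarith)) hexhaust
      measurableSet_ball (hμ.measure_ball_ne_zero x hr) (hμ.measure_ball_ne_top x r) (hf x r)
  filter_upwards [hradius.eventually_const_lt hr, (hradius.mul_const σ).eventually_lt hlim hosc]
    with x' hpos hlt using (lt_fracSharp_coe_iff hμ hf hσ).2 ⟨_, hpos, hlt⟩

theorem exists_lipschitzWith_eq_of_fracSharp_le {C : ℝ≥0} (hμ : BallsFinitePos μ)
    (hC : IsDoublingOnBalls μ C) (hf : ∀ x r, IntegrableOn f (Metric.ball x r) μ) {τ : ℝ}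
    (hτ : 0 ≤ τ) (hfτ : ∀ x, |f x| ≤ τ) (σ : ℝ≥0) :
    ∃ w : P → ℝ, LipschitzWith ((6 * C + 2 * C ^ 2) * σ) w ∧ (∀ x, |w x| ≤ τ) ∧
      ∀ x, IsBallLebesguePoint μ f x →
        fracSharp μ (fun y => (f y : EReal)) x ≤ ENNReal.ofReal σ → f x = w x := by
  obtain ⟨w, hw, hfw⟩ := (lipschitzOnWith_setOf_meanOscillation_le hμ hC hf σ).extend_real
  refine ⟨clamp τ ∘ w, by simpa using (lipschitzWith_clamp τ).comp hw,
    fun x => abs_clamp_le hτ _, fun x hx hsharp => ?_⟩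
  have hosc : ∀ r, 0 < r → meanOscillation μ f (Metric.ball x r) ≤ r * σ := by
    simpa using (lt_fracSharp_coe_iff hμ hf σ.coe_nonneg).not.1 hsharp.not_gt
  rw [Function.comp_apply, ← hfw ⟨hx, hosc⟩, clamp_eq_self (hfτ x)]

end FractionalSharpMaximalFunction

section SharpWeakEstimate

variable {P : Type*} [PseudoMetricSpace P] [MeasurableSpace P] {μ : Measure P}
  {X : QuasiBanachFunctionLattice μ} {u v : P → EReal} {f : P → ℝ}

theorem LocIntegrableOnBalls.ae_coe_toReal_eq [OpensMeasurableSpace P]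
    (hu : LocIntegrableOnBalls μ u) : ∀ᵐ y ∂μ, ((u y).toReal : EReal) = u y := by
  rcases isEmpty_or_nonempty P with _ | ⟨⟨x⟩⟩
  · exact ae_of_all _ fun y => isEmptyElim y
  have hball (n : ℕ) : ∀ᵐ y ∂μ, y ∈ Metric.ball x n → (u y).abs < ∞ :=
    (ae_restrict_iff' measurableSet_ball).1 <|
      ae_lt_top' (measurable_ereal_abs.comp_aemeasurable hu.1).restrict (hu.2 x n).ne
  filter_upwards [ae_all_iff.2 hball] with y hy
  obtain ⟨n, hn⟩ := exists_nat_gt (dist y x)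
  obtain htop | ⟨a, ha⟩ := ereal_abs_eq_top_or_exists_coe (u y)
  · exact absurd htop (hy n hn).ne
  · rw [ha, EReal.toReal_coe]

theorem LocIntegrableOnBalls.integrableOn_toReal [OpensMeasurableSpace P]
    (hu : LocIntegrableOnBalls μ u) (x : P) (r : ℝ) :
    IntegrableOn (fun y => (u y).toReal) (Metric.ball x r) μ := by
  refine ⟨hu.1.ereal_toReal.aestronglyMeasurable.restrict, ?_⟩
  refine (lintegral_congr_ae ?_).trans_lt (hu.2 x r)
  filter_upwards [ae_restrict_of_ae hu.ae_coe_toReal_eq] with y hy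
  rw [← hy, EReal.toReal_coe, EReal.abs_def, Real.enorm_eq_ofReal_abs]

theorem sharpWeakEstimate_congr (h : u =ᵐ[μ] v) :
    SharpWeakEstimate X u ↔ SharpWeakEstimate X v := by
  rw [SharpWeakEstimate, SharpWeakEstimate, fracSharp_congr h]

variable [OpensMeasurableSpace P]

theorem sharpWeakEstimate_coe_iff (hμ : BallsFinitePos μ)
    (hf : ∀ x r, IntegrableOn f (Metric.ball x r) μ) :
    SharpWeakEstimate X (fun x => (f x : EReal)) ↔ Tendsto (fun σ : ℝ => ENNReal.ofReal σ *
      X.enrm ({x | ENNReal.ofReal σ < fracSharp μ (fun y => (f y : EReal)) x}.indicator 1))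
      atTop (𝓝 0) := by
  refine tendsto_congr' ?_
  filter_upwards [eventually_ge_atTop 0] with σ hσ
  rw [X.nrm_indicator_const σ (isOpen_setOf_lt_fracSharp hμ hf hσ).measurableSet.nullMeasurableSet,
    abs_of_nonneg hσ]

theorem SharpWeakEstimate.comp_of_lipschitzWith (hμ : BallsFinitePos μ)
    (hf : ∀ x r, IntegrableOn f (Metric.ball x r) μ)
    (h : SharpWeakEstimate X fun x => (f x : EReal)) {φ : ℝ → ℝ} {K : ℝ≥0}
    (hφ : LipschitzWith K φ) : SharpWeakEstimate X fun x => (φ (f x) : EReal) := by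
  have hφf (x : P) (r : ℝ) : IntegrableOn (fun y => φ (f y)) (Metric.ball x r) μ :=
    integrableOn_comp_of_lipschitzWith hφ (hμ.measure_ball_ne_top x r) (hf x r)
  rw [sharpWeakEstimate_coe_iff hμ hf] at h
  rw [sharpWeakEstimate_coe_iff hμ hφf]
  let D : ℝ≥0 := 2 * K + 1
  have hD : (0 : ℝ) < D := by positivity
  have hlim := ENNReal.Tendsto.const_mul (a := D) (h.comp (tendsto_id.atTop_div_const hD))
    (Or.inr ENNReal.coe_ne_top)
  rw [mul_zero] at hlim
  refine tendsto_of_tendsto_of_tendsto_of_le_of_le' tendsto_const_nhds hlim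
    (Eventually.of_forall fun _ => zero_le) ?_
  filter_upwards [eventually_ge_atTop 0] with σ hσ
  have hscale : ENNReal.ofReal σ = D * ENNReal.ofReal (σ / D) := by
    rw [← ENNReal.ofReal_coe_nnreal, ← ENNReal.ofReal_mul hD.le, mul_div_cancel₀ _ hD.ne']
  have hsub : {x | ENNReal.ofReal σ < fracSharp μ (fun y => (φ (f y) : EReal)) x} ⊆
      {x | ENNReal.ofReal (σ / D) < fracSharp μ (fun y => (f y : EReal)) x} := by
    intro x hx
    have hlt : D * ENNReal.ofReal (σ / D) < D * fracSharp μ (fun y => (f y : EReal)) x :=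
      calc D * ENNReal.ofReal (σ / D) = ENNReal.ofReal σ := hscale.symm
        _ < 2 * K * fracSharp μ (fun y => (f y : EReal)) x :=
            hx.trans_le (fracSharp_comp_le hμ hf hφ x)
        _ ≤ D * fracSharp μ (fun y => (f y : EReal)) x := by
            gcongr
            exact_mod_cast le_self_add
    exact lt_of_mul_lt_mul_left' hlt
  simp only [Function.comp_apply, id]
  rw [hscale, mul_assoc, ← hscale]
  gcongr
  refine X.enrm_mono ?_ ?_ (ae_of_all _ (indicator_le_indicator_of_subset hsub fun _ => zero_le))
  · exact aemeasurable_one.indicator (isOpen_setOf_lt_fracSharp hμ hφf hσ).measurableSet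
  · exact aemeasurable_one.indicator
      (isOpen_setOf_lt_fracSharp hμ hf (by positivity)).measurableSet

theorem SharpWeakEstimate.truncation (hμ : BallsFinitePos μ) (hu : LocIntegrableOnBalls μ u)
    (h : SharpWeakEstimate X u) (τ : ℝ) : SharpWeakEstimate X (truncation u τ) := by
  have hcoe : u =ᵐ[μ] fun y => ((u y).toReal : EReal) := hu.ae_coe_toReal_eq.mono fun _ => Eq.symm
  have htrunc : _root_.truncation u τ =ᵐ[μ] fun y => (clamp τ (u y).toReal : EReal) :=
    hcoe.mono fun y => truncation_of_eq_coe
  rw [sharpWeakEstimate_congr hcoe] at h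
  rw [sharpWeakEstimate_congr htrunc]
  exact h.comp_of_lipschitzWith hμ hu.integrableOn_toReal (lipschitzWith_clamp τ)

end SharpWeakEstimate

namespace QuasiBanachFunctionLattice

section LipschitzApproximation

variable {P : Type*} [PseudoEMetricSpace P] [MeasurableSpace P] [OpensMeasurableSpace P]
  {μ : Measure P} {X : QuasiBanachFunctionLattice μ} {f : P → ℝ}

theorem newtonNorm_sub_le_of_lipschitzWith {w : P → ℝ}
    (hf : AEMeasurable (fun x => (f x : EReal)) μ) {τ K : ℝ≥0} (hfτ : ∀ x, |f x| ≤ τ)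
    (hw : LipschitzWith K w) (hwτ : ∀ x, |w x| ≤ τ) {g : P → ℝ≥0∞}
    (hg : IsUpperGradient (fun x => (f x : EReal)) g) (hgfin : X.enrm g < ∞) {E : Set P}
    (hE : NullMeasurableSet E μ) (hfw : ∀ x ∉ E, f x = w x) :
    X.newtonNorm (fun x => (f x : EReal) - w x) ≤ (2 * τ : ℝ≥0) * X.enrm (E.indicator 1) +
      X.c * (X.c * (X.enrm (E.indicator g) + K * X.enrm (E.indicator 1))) := by
  have hone : AEMeasurable (E.indicator (1 : P → ℝ≥0∞)) μ := aemeasurable_one.indicator₀ hE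
  have hgrad : IsUpperGradient (fun x => (f x : EReal) - w x) (fun x => g x + K) := by
    simpa only [sub_eq_add_neg] using hg.add (IsUpperGradient.of_lipschitzWith hw).neg
  rw [newtonNorm_eq_nrm_add_gradientNorm]
  refine add_le_add ?_ <| (gradientNorm_le_mul_enrm_indicator hg.1 hgfin hgrad hE ?_).trans <|
    by gcongr; exact X.enrm_indicator_add_const_le K hg.1.aemeasurable hE
  · rw [← X.enrm_const_mul (2 * τ) hone]
    refine X.nrm_le_enrm (aemeasurable_ereal_sub hf
      hw.continuous.measurable.aemeasurable.coe_real_ereal) (hone.const_mul _)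
      (ae_of_all _ fun x => ?_)
    rw [ereal_abs_coe_sub_coe]
    by_cases hx : x ∈ E
    · rw [indicator_of_mem hx, Pi.one_apply, mul_one]
      have hdist : dist (f x) (w x) ≤ (2 * τ : ℝ≥0) :=
        calc |f x - w x| ≤ |f x| + |w x| := abs_sub _ _
          _ ≤ (2 * τ : ℝ≥0) := by push_cast; linarith [hfτ x, hwτ x]
      exact edist_le_coe.2 (NNReal.coe_le_coe.1 hdist)
    · rw [hfw x hx, edist_self]
      exact zero_le
  · intro x hx
    rw [hfw x hx, ← EReal.coe_sub, sub_self, EReal.coe_zero]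

theorem tendsto_newtonNorm_sub_of_lipschitzWith (hX : X.AbsolutelyContinuousNorm)
    (hf : X.MemNewton fun x => (f x : EReal)) {τ D : ℝ≥0} (hfτ : ∀ x, |f x| ≤ τ) {w : ℕ → P → ℝ}
    (hw : ∀ n : ℕ, LipschitzWith (D * n) (w n)) (hwτ : ∀ n x, |w n x| ≤ τ) {E : ℕ → Set P}
    (hE : ∀ n, NullMeasurableSet (E n) μ) (hanti : Antitone E)
    (hweak : Tendsto (fun n : ℕ => n * X.enrm ((E n).indicator 1)) atTop (𝓝 0))
    (hfw : ∀ n, ∀ x ∉ E n, f x = w n x) :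
    Tendsto (fun n => X.newtonNorm fun x => (f x : EReal) - w n x) atTop (𝓝 0) := by
  obtain ⟨g, hg, hgfin⟩ := hf.exists_isUpperGradient
  have hone : Tendsto (fun n : ℕ => X.enrm ((E n).indicator 1)) atTop (𝓝 0) := by
    refine tendsto_of_tendsto_of_tendsto_of_le_of_le' tendsto_const_nhds hweak
      (Eventually.of_forall fun _ => zero_le) ?_
    filter_upwards [eventually_ge_atTop 1] with n hn
    exact le_mul_of_one_le_left zero_le (Nat.one_le_cast.2 hn)
  have hgrad : Tendsto (fun n => X.enrm ((E n).indicator g)) atTop (𝓝 0) :=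
    hX.tendsto_enrm_indicator hg.1.aemeasurable hgfin hE hanti
      (measure_iInter_eq_zero_of_tendsto_enrm hE hone)
  have hmul (a : ℝ≥0) {F : ℕ → ℝ≥0∞} (hF : Tendsto F atTop (𝓝 0)) :
      Tendsto (fun n => a * F n) atTop (𝓝 0) := by
    simpa using ENNReal.Tendsto.const_mul hF (Or.inr (ENNReal.coe_ne_top (r := a)))
  have hlim : Tendsto (fun n : ℕ => (2 * τ : ℝ≥0) * X.enrm ((E n).indicator 1) + X.c * (X.c *
      (X.enrm ((E n).indicator g) + D * (n * X.enrm ((E n).indicator 1))))) atTop (𝓝 0) := by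
    simpa using (hmul (2 * τ) hone).add
      (hmul X.c (hmul X.c (by simpa using hgrad.add (hmul D hweak))))
  refine tendsto_of_tendsto_of_tendsto_of_le_of_le tendsto_const_nhds hlim (fun _ => zero_le)
    fun n => ?_
  refine (newtonNorm_sub_le_of_lipschitzWith hf.1 hfτ (hw n) (hwτ n) hg hgfin (hE n)
    (hfw n)).trans_eq ?_
  push_cast
  rw [mul_assoc (D : ℝ≥0∞)]

end LipschitzApproximation

end QuasiBanachFunctionLattice

section Density

variable {P : Type*} [PseudoMetricSpace P] [MeasurableSpace P] [BorelSpace P] {μ : Measure P}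
  {X : QuasiBanachFunctionLattice μ} {C : ℝ≥0}

theorem exists_lipschitzWith_newtonNorm_sub_le (hμ : BallsFinitePos μ)
    (hC : IsDoublingOnBalls μ C) (hX : X.AbsolutelyContinuousNorm) {f : P → ℝ}
    (hf : X.MemNewton fun x => (f x : EReal)) {τ : ℝ≥0} (hfτ : ∀ x, |f x| ≤ τ)
    (hsharp : SharpWeakEstimate X fun x => (f x : EReal)) {η : ℝ≥0∞} (hη : 0 < η) :
    ∃ w : P → ℝ, (∃ K, LipschitzWith K w) ∧ X.newtonNorm (fun x => (f x : EReal) - w x) ≤ η := by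
  have hfi := hμ.integrableOn_of_norm_le
    (by simpa using hf.1.ereal_toReal : AEMeasurable f μ).aestronglyMeasurable hfτ
  let S (n : ℕ) : Set P := {x | ENNReal.ofReal n < fracSharp μ (fun y => (f y : EReal)) x}
  let N : Set P := {x | ¬ IsBallLebesguePoint μ f x}
  have hS (n : ℕ) : NullMeasurableSet (S n) μ :=
    (isOpen_setOf_lt_fracSharp hμ hfi n.cast_nonneg).measurableSet.nullMeasurableSet
  have hone (n : ℕ) : AEMeasurable ((S n).indicator (1 : P → ℝ≥0∞)) μ :=
    aemeasurable_one.indicator₀ (hS n)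
  have hSN (n : ℕ) : S n =ᵐ[μ] (S n ∪ N : Set P) :=
    (union_ae_eq_left_of_ae_eq_empty (ae_eq_empty.2 (ae_isBallLebesguePoint hμ hC hfi))).symm
  have hanti : Antitone fun n => S n ∪ N := fun a b hab => union_subset_union_left _ fun x hx =>
    (ENNReal.ofReal_le_ofReal (Nat.cast_le.2 hab)).trans_lt hx
  have hweak : Tendsto (fun n : ℕ => n * X.enrm ((S n ∪ N).indicator 1)) atTop (𝓝 0) := by
    refine (((sharpWeakEstimate_coe_iff hμ hfi).1 hsharp).comp
      tendsto_natCast_atTop_atTop).congr fun n => ?_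
    change ENNReal.ofReal n * X.enrm ((S n).indicator 1) = _
    rw [ENNReal.ofReal_natCast, X.enrm_congr_ae (hone n) (indicator_ae_eq_of_ae_eq_set (hSN n))]
  choose w hw hwτ hfw using fun n : ℕ =>
    exists_lipschitzWith_eq_of_fracSharp_le hμ hC hfi τ.coe_nonneg hfτ n
  have hlim := QuasiBanachFunctionLattice.tendsto_newtonNorm_sub_of_lipschitzWith hX hf hfτ hw hwτ
    (fun n => (hS n).congr (hSN n)) hanti hweak fun n x hx => by
      simp only [S, N, mem_union, not_or, mem_ofPred_eq, not_not, not_lt] at hx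
      exact hfw n x hx.2 hx.1
  obtain ⟨n, hn⟩ := (ENNReal.tendsto_nhds_zero.1 hlim η hη).exists
  exact ⟨w n, ⟨_, hw n⟩, hn⟩

theorem mainTheorem7_general (hμ : BallsFinitePos μ) (hC : IsDoublingOnBalls μ C)
    (hX : X.AbsolutelyContinuousNorm) {u : P → EReal} (hu : X.MemNewton u)
    (hsharp : (∀ τ : ℝ, 0 < τ → SharpWeakEstimate X (truncation u τ)) ∨
      (LocIntegrableOnBalls μ u ∧ SharpWeakEstimate X u)) {ε : ℝ≥0∞} (hε : 0 < ε) :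
    ∃ w : P → ℝ, (∃ K : ℝ≥0, LipschitzWith K w) ∧ X.MemNewton (fun x => (w x : EReal)) ∧
      X.newtonNorm (fun x => u x - (w x : EReal)) < ε := by
  have htrunc (τ : ℝ) (hτ : 0 < τ) : SharpWeakEstimate X (truncation u τ) :=
    hsharp.elim (fun h => h τ hτ) fun h => h.2.truncation hμ h.1 τ
  obtain ⟨η, hη, hηε⟩ : ∃ η : ℝ≥0, 0 < η ∧ η * (2 * X.c) < ε :=
    ENNReal.exists_nnreal_pos_mul_lt (by finiteness) hε.ne'
  have hη' : (0 : ℝ≥0∞) < η := ENNReal.coe_pos.2 hη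
  obtain ⟨n, hn, hn0⟩ := ((ENNReal.tendsto_nhds_zero.1 (X.tendsto_newtonNorm_sub_truncation hX hu)
    η hη').and (eventually_gt_atTop 0)).exists
  choose f hfn hf using exists_truncation_eq_coe (u := u) (n.cast_nonneg (α := ℝ))
  have hfN : X.MemNewton fun x => (f x : EReal) := by
    rw [← funext hf]
    exact hu.truncation n.cast_nonneg
  obtain ⟨w, hw, hfw⟩ := exists_lipschitzWith_newtonNorm_sub_le hμ hC hX hfN (τ := n) hfn
    (funext hf ▸ htrunc n (Nat.cast_pos.2 hn0)) hη'
  have hwm : AEMeasurable (fun x => (w x : EReal)) μ :=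
    hw.choose_spec.continuous.measurable.aemeasurable.coe_real_ereal
  have hfwN : X.MemNewton fun x => (f x : EReal) - w x :=
    ⟨aemeasurable_ereal_sub hfN.1 hwm, hfw.trans_lt ENNReal.coe_lt_top⟩
  refine ⟨w, hw, ?_, ?_⟩
  · simpa [← EReal.coe_sub, ← EReal.coe_neg, ← EReal.coe_add] using hfN.add hfwN.neg
  · simp only [hf] at hn
    calc X.newtonNorm (fun x => u x - w x)
        = X.newtonNorm (fun x => (u x - f x) + (f x - w x)) := by
          simp only [ereal_sub_coe_add_coe_sub_coe]
      _ ≤ X.c * (X.newtonNorm (fun x => u x - f x) + X.newtonNorm fun x => (f x : EReal) - w x) :=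
          X.newtonNorm_add_le (aemeasurable_ereal_sub hu.1 hfN.1) hfwN.1
      _ ≤ X.c * (η + η) := by gcongr
      _ = η * (2 * X.c) := by ring
      _ < ε := hηε

end Density

theorem mainTheorem7 {P : Type*} [MetricSpace P] [MeasurableSpace P] [BorelSpace P]
    (μ : Measure P) [SigmaFinite μ] (hnonatomic : IsNonatomic μ)
    (hball : ∀ (x : P) (r : ℝ), 0 < r →
      0 < μ (Metric.ball x r) ∧ μ (Metric.ball x r) < ∞)
    (hdoubling : ∃ C : ℝ≥0, ∀ (x : P) (r : ℝ), 0 < r →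
      μ (Metric.ball x (2 * r)) ≤ C * μ (Metric.ball x r))
    (X : QuasiBanachFunctionLattice μ) (hX : X.AbsolutelyContinuousNorm)
    (u : P → EReal) (hu : X.MemNewton u)
    (hsharp : (∀ τ : ℝ, 0 < τ → SharpWeakEstimate X (truncation u τ)) ∨
      (LocIntegrableOnBalls μ u ∧ SharpWeakEstimate X u)) :
    ∀ ε : ℝ, 0 < ε → ∃ w : P → ℝ, (∃ K : ℝ≥0, LipschitzWith K w) ∧
      X.MemNewton (fun x => (w x : EReal)) ∧
      X.newtonNorm (fun x => u x - (w x : EReal)) < ENNReal.ofReal ε := by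
  obtain ⟨C, hC⟩ := hdoubling
  exact fun ε hε => mainTheorem7_general hball hC hX hu hsharp (ENNReal.ofReal_pos.2 hε)
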